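/- For an integer $a\ge -1$ let $\rho=\rho_a$ be the largest real root of $x^3-ax^2-(a+3)x-1$, let $K=K_a=\mathbb Q(\rho)$ be the corresponding simplest cubic field, $\mathcal O_K$ its ring of integers, and $\Delta=\Delta_a$ its discriminant. Call an ideal $I$ of $\mathcal O_K$ primitive if $n\nmid I$ (that is, $n\mathcal O_K\nmid I$) for every integer $n\ge 2$. Let $\mathcal P_a(X)$ be the number of primitive principal ideals of $\mathcal O_K$ of norm at most $X$, and let $\mathcal P_a^{<}(X)$ be the number of those of norm strictly less than $X$. (1) There are absolute constants $c,C>0$ such that for every integer $a\ge 1$ with $\mathcal O_K=\mathbb Z[\rho]$ and every real $\delta\in[0,1]$, $$c\,a^{2\delta/3}\le \mathcal P_a(a^{1+\delta})\le C\,a^{2\delta/3}.$$ (2) There are absolute constants $c,C>0$ such that for every integer $a\ge -1$ with $\mathcal O_K=\mathbb Z[\rho]$, $$c\,\Delta^{1/6}\le \mathcal P_a^{<}(\Delta^{1/2})\le C\,\Delta^{1/6}.$$ -/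

import Mathlib

open Polynomial NumberField
open scoped IntermediateField

namespace SimplestCubic

/-- The polynomial `x³ - a x² - (a + 3) x - 1`. -/
noncomputable def poly (a : ℤ) : ℤ[X] :=
  X ^ 3 - C a * X ^ 2 - C (a + 3) * X - 1

/-- The set of real roots of `poly a`. -/
def realRoots (a : ℤ) : Set ℝ :=
  {x | x ^ 3 - (a : ℝ) * x ^ 2 - ((a : ℝ) + 3) * x - 1 = 0}

/-- The largest real root of `poly a`; see `isGreatest_rho`. -/
noncomputable def rho (a : ℤ) : ℝ := sSup (realRoots a)

theorem poly_monic (a : ℤ) : (poly a).Monic := by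
  unfold poly
  monicity!

theorem mem_realRoots_iff (a : ℤ) (x : ℝ) : x ∈ realRoots a ↔ aeval x (poly a) = 0 := by
  simp [realRoots, poly, map_ofNat]

theorem isGreatest_rho (a : ℤ) : IsGreatest (realRoots a) (rho a) := by
  have hfin : (realRoots a).Finite := by
    refine ((((poly a).map (Int.castRingHom ℝ)).roots.toFinset).finite_toSet).subset ?_
    intro x hx
    have h0 : (poly a).map (Int.castRingHom ℝ) ≠ 0 := ((poly_monic a).map _).ne_zero
    rw [mem_realRoots_iff] at hx
    simpa [h0, eval_map, aeval_def] using hx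
  have hne : (realRoots a).Nonempty := by
    have hc : Continuous
        (fun x : ℝ => x ^ 3 - (a : ℝ) * x ^ 2 - ((a : ℝ) + 3) * x - 1) := by fun_prop
    set M : ℝ := |(a : ℝ)| + 3
    have h1 : (a : ℝ) ≤ |(a : ℝ)| := le_abs_self _
    have h2 : -(a : ℝ) ≤ |(a : ℝ)| := neg_le_abs _
    have h3 : 0 ≤ |(a : ℝ)| := abs_nonneg _
    obtain ⟨x, -, hx⟩ := intermediate_value_Icc (a := (0 : ℝ)) (b := M) (by positivity)
      hc.continuousOn (show (0 : ℝ) ∈ _ from ⟨by norm_num, by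
        show (0 : ℝ) ≤ M ^ 3 - (a : ℝ) * M ^ 2 - ((a : ℝ) + 3) * M - 1
        have hM : M = |(a : ℝ)| + 3 := rfl
        nlinarith [mul_nonneg h3 h3, mul_nonneg (sub_nonneg.2 h1) (sq_nonneg M),
          mul_nonneg (sub_nonneg.2 h1) (show 0 ≤ M by positivity)]⟩)
    exact ⟨x, hx⟩
  exact hfin.isCompact.isGreatest_sSup hne

theorem aeval_rho (a : ℤ) : aeval (rho a) (poly a) = 0 :=
  (mem_realRoots_iff a _).1 (isGreatest_rho a).1

theorem isIntegral_rho (a : ℤ) : IsIntegral ℤ (rho a) :=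
  ⟨poly a, poly_monic a, aeval_rho a⟩

/-- The simplest cubic field `ℚ(ρ)` with parameter `a`, as a subfield of `ℝ`. -/
noncomputable abbrev CubicField (a : ℤ) : IntermediateField ℚ ℝ := ℚ⟮rho a⟯

instance (a : ℤ) : NumberField (CubicField a) where
  to_charZero := inferInstance
  to_finiteDimensional :=
    IntermediateField.adjoin.finiteDimensional ((isIntegral_rho a).tower_top)

/-- `ρ` as an element of the ring of integers of `ℚ(ρ)`. -/
noncomputable def rhoInt (a : ℤ) : 𝓞 (CubicField a) :=
  ⟨IntermediateField.AdjoinSimple.gen ℚ (rho a),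
    (isIntegral_algebraMap_iff (algebraMap (CubicField a) ℝ).injective).1 (by
      rw [IntermediateField.AdjoinSimple.algebraMap_gen]; exact isIntegral_rho a)⟩

/-- The condition `𝓞_K = ℤ[ρ]`. -/
def IsMonogenic (a : ℤ) : Prop :=
  Algebra.adjoin ℤ {rhoInt a} = (⊤ : Subalgebra ℤ (𝓞 (CubicField a)))

/-- An ideal is primitive if it is not divisible by any rational integer `n ≥ 2`. -/
def IsPrimitive {R : Type*} [CommRing R] (I : Ideal R) : Prop :=
  ∀ n : ℕ, 2 ≤ n → ¬ Ideal.span {(n : R)} ∣ I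

/-- The set of primitive principal ideals of the ring of integers of `ℚ(ρ)`. -/
def primitivePrincipalIdeals (a : ℤ) : Set (Ideal (𝓞 (CubicField a))) :=
  {I | IsPrimitive I ∧ Submodule.IsPrincipal I}

/-- The number of primitive principal ideals of norm at most `x`. -/
noncomputable def count (a : ℤ) (x : ℝ) : ℕ :=
  {I ∈ primitivePrincipalIdeals a | (Ideal.absNorm I : ℝ) ≤ x}.ncard

/-- The number of primitive principal ideals of norm less than `x`. -/
noncomputable def countLT (a : ℤ) (x : ℝ) : ℕ :=
  {I ∈ primitivePrincipalIdeals a | (Ideal.absNorm I : ℝ) < x}.ncard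

end SimplestCubic

open Polynomial NumberField
open scoped IntermediateField

namespace SimplestCubic

/-! Put s = (X/a)^(1/3). For a ≥ 100 and a ≤ X ≤ 2a², both halves reduce to showing that the number
of primitive principal ideals of norm up to X has order s². The choice X = a^(1+δ) gives s² =
a^(2δ/3); the choice X = Δ^(1/2) = a² + 3a + 9 gives s² of order Δ^(1/6). The finitely many smaller
a are absorbed into the constants.

The conjugates of ρ ≈ a are near 0 and -1, and x + yρ has norm a·xy(x - y) plus a cubic form in x, y
free of a (`norm_elt`).

Upper bound: multiplying a generator by powers of the units ρ and 1 + ρ puts its second and third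
conjugates in windows of ratio O(ρ) (`exists_unit_reduce`); only the independence of these units is
used. Interpolation at the three conjugates then bounds the coordinates on 1, ρ, ρ². If the first
conjugate is small against ρ², then z = 0 and x, y are small against a; otherwise the norm bound
makes all coordinates O(1) (`exists_associate_small`). In the first case the norm is at least half
its main term, so 0 < |xy(x - y)| = O(s³) or xy(x - y) = 0. The former has O(s²) solutions
(`mem_thuePairs`, `card_thuePairs_le`); the latter leaves only tiny pairs by primitivity.

Lower bound: take -m + nρ with m, n coprime in (T/10, T] and T of order s. There are at least 3T²/10
of them, of norm at most 3aT³. Corresponding conjugates of any two are comparable, so a unit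
relating them has bounded conjugates, hence is a rational integer (`eq_intCast_of_embeddings_le`),
and the ideals are distinct. -/

/-! ### Arithmetic of ℤ[ρ]: integral basis, trace, discriminant. -/

theorem natDegree_poly (a : ℤ) : (poly a).natDegree = 3 := by
  unfold poly
  compute_degree!

/-- An integer root would be a unit, and the values at 1 and -1 are -2a - 3 and 1. -/
theorem irreducible_poly (a : ℤ) : Irreducible (poly a) := by
  rw [(poly_monic a).irreducible_iff_roots_eq_zero_of_degree_le_three
    (by rw [natDegree_poly]; norm_num) (by rw [natDegree_poly])]
  refine Multiset.eq_zero_of_forall_notMem fun x hx => ?_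
  have h : x ^ 3 - a * x ^ 2 - (a + 3) * x - 1 = 0 := by
    simpa [poly] using (mem_roots'.1 hx).2
  have hu : IsUnit x :=
    IsUnit.of_mul_eq_one (x ^ 2 - a * x - (a + 3)) (by linear_combination h)
  rcases Int.isUnit_iff.1 hu with rfl | rfl <;> omega

theorem aeval_rhoInt (a : ℤ) : aeval (rhoInt a) (poly a) = 0 := by
  have hinj : Function.Injective (algebraMap (𝓞 (CubicField a)) ℝ) :=
    FaithfulSMul.algebraMap_injective _ _
  apply hinj
  rw [← aeval_algebraMap_apply, map_zero]
  exact aeval_rho a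

theorem rhoInt_cubic (a : ℤ) :
    rhoInt a ^ 3 = a * rhoInt a ^ 2 + (a + 3) * rhoInt a + 1 := by
  have h := aeval_rhoInt a
  simp only [poly, map_sub, map_mul, map_pow, aeval_X, aeval_C, map_one] at h
  simp only [algebraMap_int_eq, eq_intCast, Int.cast_add, Int.cast_ofNat] at h
  linear_combination h

theorem isIntegral_rhoInt (a : ℤ) : IsIntegral ℤ (rhoInt a) :=
  ⟨poly a, poly_monic a, aeval_rhoInt a⟩

theorem minpoly_rhoInt (a : ℤ) : minpoly ℤ (rhoInt a) = poly a := by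
  have hdvd := minpoly.isIntegrallyClosed_dvd (isIntegral_rhoInt a) (aeval_rhoInt a)
  exact eq_of_monic_of_associated (minpoly.monic (isIntegral_rhoInt a)) (poly_monic a)
    (((irreducible_poly a).dvd_iff.1 hdvd).resolve_left (minpoly.not_isUnit ℤ (rhoInt a))).symm

/-- The power basis `1, ρ, ρ²` of the ring of integers. -/
noncomputable def powerBasis {a : ℤ} (h : IsMonogenic a) : PowerBasis ℤ (𝓞 (CubicField a)) :=
  PowerBasis.ofAdjoinEqTop' (isIntegral_rhoInt a) h

theorem powerBasis_gen {a : ℤ} (h : IsMonogenic a) : (powerBasis h).gen = rhoInt a :=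
  PowerBasis.ofAdjoinEqTop'_gen _ _

theorem powerBasis_dim {a : ℤ} (h : IsMonogenic a) : (powerBasis h).dim = 3 := by
  rw [show (powerBasis h).dim = (minpoly ℤ (rhoInt a)).natDegree from rfl, minpoly_rhoInt a,
    natDegree_poly]

/-- The integral basis `1, ρ, ρ²` indexed by `Fin 3`. -/
noncomputable def intBasis {a : ℤ} (h : IsMonogenic a) :
    Module.Basis (Fin 3) ℤ (𝓞 (CubicField a)) :=
  (powerBasis h).basis.reindex (finCongr (powerBasis_dim h))

theorem intBasis_apply {a : ℤ} (h : IsMonogenic a) (i : Fin 3) :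
    intBasis h i = rhoInt a ^ (i : ℕ) := by
  simp [intBasis, powerBasis_gen]

/-- The integer `x + yρ + zρ²`. -/
noncomputable def elt (a x y z : ℤ) : 𝓞 (CubicField a) :=
  x + y * rhoInt a + z * rhoInt a ^ 2

theorem elt_eq_sum {a : ℤ} (h : IsMonogenic a) (x y z : ℤ) :
    elt a x y z = ∑ i, ![x, y, z] i • intBasis h i := by
  simp [Fin.sum_univ_three, intBasis_apply, elt]

theorem repr_elt {a : ℤ} (h : IsMonogenic a) (x y z : ℤ) (i : Fin 3) :
    (intBasis h).repr (elt a x y z) i = ![x, y, z] i := by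
  rw [elt_eq_sum h, (intBasis h).repr_sum_self]

theorem exists_eq_elt {a : ℤ} (h : IsMonogenic a) (α : 𝓞 (CubicField a)) :
    ∃ x y z : ℤ, α = elt a x y z := by
  refine ⟨(intBasis h).repr α 0, (intBasis h).repr α 1, (intBasis h).repr α 2, ?_⟩
  conv_lhs => rw [← (intBasis h).sum_repr α]
  rw [elt_eq_sum h]
  simp [Fin.sum_univ_three]

theorem elt_inj {a : ℤ} (h : IsMonogenic a) {x y z x' y' z' : ℤ} :
    elt a x y z = elt a x' y' z' ↔ x = x' ∧ y = y' ∧ z = z' := by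
  constructor
  · intro he
    have hr := fun i => (repr_elt h x y z i).symm.trans
      ((congrArg (fun t => (intBasis h).repr t i) he).trans (repr_elt h x' y' z' i))
    exact ⟨by simpa using hr 0, by simpa using hr 1, by simpa using hr 2⟩
  · rintro ⟨rfl, rfl, rfl⟩; rfl

theorem leftMulMatrix_elt {a : ℤ} (h : IsMonogenic a) (x y z : ℤ) :
    Algebra.leftMulMatrix (intBasis h) (elt a x y z) =
      !![x, z, y + a * z;
         y, x + (a + 3) * z, (a + 3) * y + (a * (a + 3) + 1) * z;
         z, y + a * z, x + a * y + (a ^ 2 + a + 3) * z] := by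
  have h3 := rhoInt_cubic a
  have e0 : elt a x y z * rhoInt a ^ 0 = elt a x y z := by simp
  have e1 : elt a x y z * rhoInt a ^ 1 = elt a z (x + (a + 3) * z) (y + a * z) := by
    simp only [elt]; push_cast; linear_combination (z : 𝓞 (CubicField a)) * h3
  have e2 : elt a x y z * rhoInt a ^ 2 = elt a (y + a * z)
      ((a + 3) * y + (a * (a + 3) + 1) * z) (x + a * y + (a ^ 2 + a + 3) * z) := by
    simp only [elt]; push_cast
    linear_combination ((y : 𝓞 (CubicField a)) + z * (rhoInt a + a)) * h3
  ext i j
  rw [Algebra.leftMulMatrix_eq_repr_mul, intBasis_apply]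
  fin_cases j
  · change (intBasis h).repr (elt a x y z * rhoInt a ^ 0) i = _
    rw [e0, repr_elt]; fin_cases i <;> rfl
  · change (intBasis h).repr (elt a x y z * rhoInt a ^ 1) i = _
    rw [e1, repr_elt]; fin_cases i <;> rfl
  · change (intBasis h).repr (elt a x y z * rhoInt a ^ 2) i = _
    rw [e2, repr_elt]; fin_cases i <;> rfl

theorem trace_elt {a : ℤ} (h : IsMonogenic a) (x y z : ℤ) :
    Algebra.trace ℤ (𝓞 (CubicField a)) (elt a x y z) =
      3 * x + a * y + (a ^ 2 + 2 * a + 6) * z := by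
  rw [Algebra.trace_eq_matrix_trace (intBasis h), leftMulMatrix_elt, Matrix.trace_fin_three]
  simp; ring

theorem discr_eq {a : ℤ} (h : IsMonogenic a) :
    NumberField.discr (CubicField a) = (a ^ 2 + 3 * a + 9) ^ 2 := by
  rw [← NumberField.discr_eq_discr _ (intBasis h), Algebra.discr_def]
  have h3 := rhoInt_cubic a
  have p0 : rhoInt a ^ 0 = elt a 1 0 0 := by simp [elt]
  have p1 : rhoInt a ^ 1 = elt a 0 1 0 := by simp [elt]
  have p2 : rhoInt a ^ 2 = elt a 0 0 1 := by simp [elt]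
  have p3 : rhoInt a ^ 3 = elt a 1 (a + 3) a := by rw [h3]; simp only [elt]; push_cast; ring
  have p4 : rhoInt a ^ 4 = elt a a (a * (a + 3) + 1) (a ^ 2 + a + 3) := by
    simp only [elt]; push_cast; linear_combination (rhoInt a + a) * h3
  have ht : ∀ i j : Fin 3, Algebra.traceMatrix ℤ (intBasis h) i j =
      Algebra.trace ℤ (𝓞 (CubicField a)) (rhoInt a ^ (i + j : ℕ)) := fun i j => by
    rw [Algebra.traceMatrix_apply, Algebra.traceForm_apply, intBasis_apply, intBasis_apply, pow_add]
  have t0 := trace_elt h 1 0 0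
  have t1 := trace_elt h 0 1 0
  have t2 := trace_elt h 0 0 1
  have t3 := trace_elt h 1 (a + 3) a
  have t4 := trace_elt h a (a * (a + 3) + 1) (a ^ 2 + a + 3)
  rw [← p0] at t0
  rw [← p1] at t1
  rw [← p2] at t2
  rw [← p3] at t3
  rw [← p4] at t4
  rw [Matrix.det_fin_three]
  simp only [ht, Fin.val_zero, Fin.val_one, Fin.val_two, Nat.reduceAdd]
  simp only [t0, t1, t2, t3, t4]
  ring

/-! ### Real embeddings and the norm. -/

/-- The ring homomorphism `𝓞_K → ℝ` sending `ρ` to a given real root of `poly a`. -/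
noncomputable def realEmb {a : ℤ} (h : IsMonogenic a) (r : ℝ)
    (hr : aeval r (poly a) = 0) : 𝓞 (CubicField a) →ₐ[ℤ] ℝ :=
  (powerBasis h).lift r (by rw [powerBasis_gen, minpoly_rhoInt a]; exact hr)

theorem realEmb_rhoInt {a : ℤ} (h : IsMonogenic a) (r : ℝ)
    (hr : aeval r (poly a) = 0) : realEmb h r hr (rhoInt a) = r := by
  conv_lhs => rw [← powerBasis_gen h]
  exact PowerBasis.lift_gen _ _ _

theorem realEmb_elt {a : ℤ} (h : IsMonogenic a) (r : ℝ)
    (hr : aeval r (poly a) = 0) (x y z : ℤ) :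
    realEmb h r hr (elt a x y z) = x + y * r + z * r ^ 2 := by
  simp [elt, realEmb_rhoInt]

theorem rho_cubic (a : ℤ) :
    rho a ^ 3 - a * rho a ^ 2 - (a + 3) * rho a - 1 = 0 := (isGreatest_rho a).1

theorem rho_bounds {a : ℤ} (ha : 0 ≤ a) : (a : ℝ) + 1 ≤ rho a ∧ rho a ≤ a + 2 := by
  have ha' : (0 : ℝ) ≤ a := by exact_mod_cast ha
  have hc : ContinuousOn (fun x : ℝ => x ^ 3 - (a : ℝ) * x ^ 2 - ((a : ℝ) + 3) * x - 1)
      (Set.Icc (a + 1) (a + 2)) := by fun_prop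
  obtain ⟨x, hx, hx0⟩ := intermediate_value_Icc (by linarith) hc
    (show (0 : ℝ) ∈ _ from ⟨by ring_nf; nlinarith, by ring_nf; nlinarith⟩)
  refine ⟨hx.1.trans ((isGreatest_rho a).2 hx0), ?_⟩
  by_contra! hlt
  have h0 := rho_cubic a
  nlinarith [mul_pos (sub_pos.2 hlt) (sub_pos.2 hlt), mul_nonneg ha' (sub_pos.2 hlt).le,
    mul_pos (mul_pos (sub_pos.2 hlt) (sub_pos.2 hlt)) (sub_pos.2 hlt),
    mul_nonneg ha' (mul_pos (sub_pos.2 hlt) (sub_pos.2 hlt)).le,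
    mul_nonneg (mul_nonneg ha' ha') (sub_pos.2 hlt).le]

theorem rho_pos {a : ℤ} (ha : 0 ≤ a) : 0 < rho a := by
  have := (rho_bounds ha).1
  have ha' : (0 : ℝ) ≤ a := by exact_mod_cast ha
  linarith

/-- The second root `-1/(1+ρ)`. -/
noncomputable def rho₁ (a : ℤ) : ℝ := -1 / (1 + rho a)

/-- The third root `-(1+ρ)/ρ`. -/
noncomputable def rho₂ (a : ℤ) : ℝ := -(1 + rho a) / rho a

theorem aeval_rho₁ {a : ℤ} (ha : 0 ≤ a) : aeval (rho₁ a) (poly a) = 0 := by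
  rw [← mem_realRoots_iff]
  have h := rho_pos ha
  have h' : 1 + rho a ≠ 0 := by positivity
  have h0 := rho_cubic a
  simp only [realRoots, Set.mem_ofPred_eq, rho₁]
  field_simp
  linear_combination -h0

theorem aeval_rho₂ {a : ℤ} (ha : 0 ≤ a) : aeval (rho₂ a) (poly a) = 0 := by
  rw [← mem_realRoots_iff]
  have h := rho_pos ha
  have h0 := rho_cubic a
  simp only [realRoots, Set.mem_ofPred_eq, rho₂]
  field_simp
  linear_combination h0

/-- The inclusion `𝓞_K → ℝ`. -/
noncomputable def φ₀ {a : ℤ} (_ha : 0 ≤ a) (h : IsMonogenic a) : 𝓞 (CubicField a) →ₐ[ℤ] ℝ :=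
  realEmb h (rho a) (aeval_rho a)

/-- The embedding `ρ ↦ -1/(1+ρ)`. -/
noncomputable def φ₁ {a : ℤ} (ha : 0 ≤ a) (h : IsMonogenic a) : 𝓞 (CubicField a) →ₐ[ℤ] ℝ :=
  realEmb h (rho₁ a) (aeval_rho₁ ha)

/-- The embedding `ρ ↦ -(1+ρ)/ρ`. -/
noncomputable def φ₂ {a : ℤ} (ha : 0 ≤ a) (h : IsMonogenic a) : 𝓞 (CubicField a) →ₐ[ℤ] ℝ :=
  realEmb h (rho₂ a) (aeval_rho₂ ha)

theorem norm_elt {a : ℤ} (h : IsMonogenic a) (x y : ℤ) :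
    Algebra.norm ℤ (elt a x y 0) = a * (x * y * (x - y)) + (x ^ 3 - 3 * x * y ^ 2 + y ^ 3) := by
  rw [Algebra.norm_eq_matrix_det (intBasis h), leftMulMatrix_elt, Matrix.det_fin_three]
  simp
  ring

theorem norm_eq_prod {a : ℤ} (ha : 0 ≤ a) (h : IsMonogenic a) (α : 𝓞 (CubicField a)) :
    (Algebra.norm ℤ α : ℝ) = φ₀ ha h α * φ₁ ha h α * φ₂ ha h α := by
  obtain ⟨x, y, z, rfl⟩ := exists_eq_elt h α
  rw [Algebra.norm_eq_matrix_det (intBasis h), leftMulMatrix_elt, Matrix.det_fin_three]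
  simp only [φ₀, φ₁, φ₂, realEmb_elt]
  have hp := rho_pos ha
  have hp' : 1 + rho a ≠ 0 := by positivity
  have h0 := rho_cubic a
  -- The cubic is linear in a. Eliminating a turns the claim into a rational identity in ρ, x, y, z.
  have haeq : (a : ℝ) = (rho a ^ 3 - 3 * rho a - 1) / (rho a * (1 + rho a)) := by
    field_simp; linear_combination -h0
  simp only [Matrix.of_apply, Matrix.cons_val', Matrix.cons_val_zero, Matrix.cons_val_one,
    Matrix.cons_val, Matrix.cons_val_fin_one]
  push_cast
  rw [haeq, rho₁, rho₂]
  field_simp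
  ring

/-! ### Reduction modulo the units ρ and 1 + ρ. -/

/-- Translation of (b, d) into w plus a fundamental parallelogram of the lattice spanned by (L₀ + h,
-h) and (h, L₀). With L₀ = log ρ and h = log((1 + ρ)/ρ), these are minus the logarithmic vectors of
ρ and 1 + ρ at the second and third embeddings. -/
theorem exists_int_reduce {L₀ h : ℝ} (hL : 0 < L₀) (hh : 0 ≤ h) (b d w : ℝ) :
    ∃ m n : ℤ,
      (w ≤ b - m * (L₀ + h) - n * h ∧ b - m * (L₀ + h) - n * h ≤ w + (L₀ + h) + h) ∧
      (w - h ≤ d + m * h - n * L₀ ∧ d + m * h - n * L₀ ≤ w + L₀) := by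
  have hD : 0 < (L₀ + h) * L₀ + h ^ 2 := by positivity
  -- Cramer's rule gives the coordinates s, t of (b - w, d - w) in the lattice basis; their floors
  -- are the witnesses.
  obtain ⟨s, hs⟩ : ∃ s, s = ((b - w) * L₀ - h * (d - w)) / ((L₀ + h) * L₀ + h ^ 2) := ⟨_, rfl⟩
  obtain ⟨t, ht⟩ : ∃ t, t = ((L₀ + h) * (d - w) + h * (b - w)) / ((L₀ + h) * L₀ + h ^ 2) :=
    ⟨_, rfl⟩
  have e1 : b = w + s * (L₀ + h) + t * h := by rw [hs, ht]; field_simp; ring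
  have e2 : d = w - s * h + t * L₀ := by rw [hs, ht]; field_simp; ring
  have s1 := Int.floor_le s
  have s2 := (Int.lt_floor_add_one s).le
  have t1 := Int.floor_le t
  have t2 := (Int.lt_floor_add_one t).le
  refine ⟨⌊s⌋, ⌊t⌋, ?_⟩
  have := mul_le_mul_of_nonneg_right s1 (add_nonneg hL.le hh)
  have := mul_le_mul_of_nonneg_right s2 (add_nonneg hL.le hh)
  have := mul_le_mul_of_nonneg_right t1 hh
  have := mul_le_mul_of_nonneg_right t2 hh
  have := mul_le_mul_of_nonneg_right s1 hh
  have := mul_le_mul_of_nonneg_right s2 hh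
  have := mul_le_mul_of_nonneg_right t1 hL.le
  have := mul_le_mul_of_nonneg_right t2 hL.le
  rw [e1, e2]
  refine ⟨⟨?_, ?_⟩, ?_, ?_⟩ <;> linarith

/-- The unit `ρ`. -/
noncomputable def rhoUnit (a : ℤ) : (𝓞 (CubicField a))ˣ :=
  Units.mkOfMulEqOne (rhoInt a) (rhoInt a ^ 2 - a * rhoInt a - (a + 3))
    (by linear_combination rhoInt_cubic a)

/-- The unit `1 + ρ`. -/
noncomputable def oneAddRhoUnit (a : ℤ) : (𝓞 (CubicField a))ˣ :=
  Units.mkOfMulEqOne (1 + rhoInt a) (-(rhoInt a ^ 2 - (a + 1) * rhoInt a - 2))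
    (by linear_combination -rhoInt_cubic a)

section Embeddings

variable {a : ℤ} (ha : 0 ≤ a) (h : IsMonogenic a)

theorem φ₀_elt (x y z : ℤ) : φ₀ ha h (elt a x y z) = x + y * rho a + z * rho a ^ 2 :=
  realEmb_elt _ _ _ _ _ _

theorem φ₁_elt (x y z : ℤ) : φ₁ ha h (elt a x y z) = x + y * rho₁ a + z * rho₁ a ^ 2 :=
  realEmb_elt _ _ _ _ _ _

theorem φ₂_elt (x y z : ℤ) : φ₂ ha h (elt a x y z) = x + y * rho₂ a + z * rho₂ a ^ 2 :=
  realEmb_elt _ _ _ _ _ _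

theorem abs_φ₁_rhoUnit : |φ₁ ha h (rhoUnit a)| = (1 + rho a)⁻¹ := by
  have hp := rho_pos ha
  change |realEmb h _ _ (rhoInt a)| = _
  rw [realEmb_rhoInt, rho₁, abs_div, abs_neg, abs_one, abs_of_pos (by positivity), one_div]

theorem abs_φ₂_rhoUnit : |φ₂ ha h (rhoUnit a)| = (1 + rho a) / rho a := by
  have hp := rho_pos ha
  change |realEmb h _ _ (rhoInt a)| = _
  rw [realEmb_rhoInt, rho₂, abs_div, abs_neg, abs_of_pos hp, abs_of_pos (by positivity)]

theorem abs_φ₁_oneAddRhoUnit : |φ₁ ha h (oneAddRhoUnit a)| = ((1 + rho a) / rho a)⁻¹ := by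
  have hp := rho_pos ha
  have e : φ₁ ha h (oneAddRhoUnit a) = 1 + rho₁ a := by
    change φ₁ ha h (1 + rhoInt a) = _
    rw [map_add, map_one, φ₁, realEmb_rhoInt]
  rw [e, rho₁, show 1 + -1 / (1 + rho a) = rho a / (1 + rho a) by field_simp; ring,
    abs_of_pos (by positivity), inv_div]

theorem abs_φ₂_oneAddRhoUnit : |φ₂ ha h (oneAddRhoUnit a)| = (rho a)⁻¹ := by
  have hp := rho_pos ha
  have e : φ₂ ha h (oneAddRhoUnit a) = 1 + rho₂ a := by
    change φ₂ ha h (1 + rhoInt a) = _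
    rw [map_add, map_one, φ₂, realEmb_rhoInt]
  rw [e, rho₂, show 1 + -(1 + rho a) / rho a = -(rho a)⁻¹ by field_simp; ring,
    abs_neg, abs_of_pos (by positivity)]

theorem embeddings_ne_zero {α : 𝓞 (CubicField a)} (hα : α ≠ 0) :
    φ₀ ha h α ≠ 0 ∧ φ₁ ha h α ≠ 0 ∧ φ₂ ha h α ≠ 0 := by
  have hn : (Algebra.norm ℤ α : ℝ) ≠ 0 := by
    exact_mod_cast Algebra.norm_ne_zero_iff.2 hα
  rw [norm_eq_prod ha h] at hn
  simpa [and_assoc] using hn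

theorem log_abs_map_unit (φ : 𝓞 (CubicField a) →ₐ[ℤ] ℝ) (u v : (𝓞 (CubicField a))ˣ) (m n : ℤ)
    {β : 𝓞 (CubicField a)} (hβ : φ β ≠ 0) :
    Real.log |φ ((u ^ m * v ^ n : (𝓞 (CubicField a))ˣ) * β)| =
      Real.log |φ β| + m * Real.log |φ u| + n * Real.log |φ v| := by
  have hz : ∀ (w : (𝓞 (CubicField a))ˣ) (k : ℤ), φ (w ^ k : (𝓞 (CubicField a))ˣ) = φ w ^ k := by
    intro w k
    have := congrArg Units.val (map_zpow (Units.map (φ : 𝓞 (CubicField a) →* ℝ)) w k)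
    rw [Units.val_zpow_eq_zpow_val] at this
    exact this
  have hu : ∀ w : (𝓞 (CubicField a))ˣ, φ w ≠ 0 := fun w => (w.isUnit.map φ).ne_zero
  rw [map_mul, Units.val_mul, map_mul, hz, hz, abs_mul, abs_mul, abs_zpow, abs_zpow,
    Real.log_mul, Real.log_mul, Real.log_zpow, Real.log_zpow]
  · ring
  all_goals simp [hu, hβ, zpow_ne_zero]

/-- Every nonzero element has an associate whose second and third conjugates lie in windows
of ratio about `ρ`. -/
theorem exists_unit_reduce {θ : ℝ} (hθ : 0 < θ) {α : 𝓞 (CubicField a)} (hα : α ≠ 0) :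
    ∃ u : (𝓞 (CubicField a))ˣ,
      (θ ≤ |φ₁ ha h (u * α)| ∧ |φ₁ ha h (u * α)| ≤ 4 * θ * rho a) ∧
      (θ / 2 ≤ |φ₂ ha h (u * α)| ∧ |φ₂ ha h (u * α)| ≤ θ * rho a) := by
  have hp := rho_pos ha
  have hR : 1 ≤ rho a := by
    have := (rho_bounds ha).1
    have ha' : (0 : ℝ) ≤ a := by exact_mod_cast ha
    linarith
  obtain ⟨-, h1, h2⟩ := embeddings_ne_zero ha h hα
  have hL1 : Real.log (1 + rho a) = Real.log (rho a) + Real.log ((1 + rho a) / rho a) := by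
    rw [Real.log_div (by positivity) hp.ne']; ring
  have hh : 0 ≤ Real.log ((1 + rho a) / rho a) :=
    Real.log_nonneg (by rw [le_div_iff₀ hp]; linarith)
  have hq : (1 + rho a) / rho a ≤ 2 := by rw [div_le_iff₀ hp]; linarith
  have hR1 : 1 < rho a := by
    rcases hR.lt_or_eq with h | h
    · exact h
    · have := rho_cubic a
      rw [← h] at this
      have ha' : (0 : ℝ) ≤ a := by exact_mod_cast ha
      exfalso; nlinarith
  obtain ⟨m, n, ⟨b1, b2⟩, b3, b4⟩ := exists_int_reduce (Real.log_pos hR1) hh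
    (Real.log |φ₁ ha h α|) (Real.log |φ₂ ha h α|) (Real.log θ)
  refine ⟨rhoUnit a ^ m * oneAddRhoUnit a ^ n, ?_⟩
  have hne : ((rhoUnit a ^ m * oneAddRhoUnit a ^ n : (𝓞 (CubicField a))ˣ) : 𝓞 (CubicField a)) * α
      ≠ 0 := mul_ne_zero (Units.ne_zero _) hα
  obtain ⟨-, g1, g2⟩ := embeddings_ne_zero ha h hne
  have l1 := log_abs_map_unit (φ₁ ha h) (rhoUnit a) (oneAddRhoUnit a) m n h1
  have l2 := log_abs_map_unit (φ₂ ha h) (rhoUnit a) (oneAddRhoUnit a) m n h2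
  rw [abs_φ₁_rhoUnit, abs_φ₁_oneAddRhoUnit, Real.log_inv, Real.log_inv, hL1] at l1
  rw [abs_φ₂_rhoUnit, abs_φ₂_oneAddRhoUnit, Real.log_inv] at l2
  have k2 : 0 < (1 + rho a) / rho a := by positivity
  refine ⟨⟨?_, ?_⟩, ?_, ?_⟩
  · rw [← Real.log_le_log_iff hθ (abs_pos.2 g1), l1]; linarith
  · refine le_trans (b := θ * (1 + rho a) * ((1 + rho a) / rho a)) ?_ ?_
    · rw [← Real.log_le_log_iff (abs_pos.2 g1) (by positivity), l1,
        Real.log_mul (by positivity) (by positivity), Real.log_mul (by positivity) (by positivity)]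
      linarith
    · calc θ * (1 + rho a) * ((1 + rho a) / rho a) ≤ θ * (1 + rho a) * 2 := by gcongr
        _ ≤ θ * (rho a + rho a) * 2 := by gcongr
        _ = 4 * θ * rho a := by ring
  · refine le_trans (b := θ / ((1 + rho a) / rho a)) (by gcongr) ?_
    rw [← Real.log_le_log_iff (by positivity) (abs_pos.2 g2), l2,
      Real.log_div (by positivity) (by positivity)]
    linarith
  · rw [← Real.log_le_log_iff (abs_pos.2 g2) (by positivity), l2,
      Real.log_mul (by positivity) (by positivity)]
    linarith

end Embeddings

/-! ### From conjugates to coordinates; small associates. -/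

/-- Lagrange interpolation of the quadratic x + yt + zt² at R, r₁, r₂: z is a second divided
difference, y + z(r₁ + r₂) a first one. The nodes are well separated, with r₁ - r₂ between 1 and 2
and the other gaps at least R. -/
theorem interpolation_bounds {R r₁ r₂ x y z : ℝ} (hR : 1 ≤ R) (h₁ : r₁ = -1 / (1 + R))
    (h₂ : r₂ = -(1 + R) / R) :
    |z| * R ^ 2 ≤ 2 * |x + y * R + z * R ^ 2| + (R + 2) * |x + y * r₁ + z * r₁ ^ 2| +
      (R + 1) * |x + y * r₂ + z * r₂ ^ 2| ∧
    |y| ≤ |x + y * r₁ + z * r₁ ^ 2| + |x + y * r₂ + z * r₂ ^ 2| + 3 * |z| ∧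
    |x| ≤ |x + y * r₁ + z * r₁ ^ 2| + |y| + |z| := by
  have hR0 : 0 < R := by linarith
  have hi : 0 < R⁻¹ ∧ R⁻¹ ≤ 1 := ⟨inv_pos.2 hR0, inv_le_one_of_one_le₀ hR⟩
  have hj : 0 < (1 + R)⁻¹ ∧ (1 + R)⁻¹ ≤ 1 :=
    ⟨inv_pos.2 (by linarith), inv_le_one_of_one_le₀ (by linarith)⟩
  have hij : (1 + R)⁻¹ ≤ R⁻¹ := inv_anti₀ hR0 (by linarith)
  have e₁ : r₁ = -(1 + R)⁻¹ := by rw [h₁]; ring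
  have e₂ : r₂ = -1 - R⁻¹ := by rw [h₂]; field_simp; ring
  clear h₁ h₂
  have d12 : 1 ≤ r₁ - r₂ ∧ r₁ - r₂ ≤ 2 := ⟨by linarith, by linarith⟩
  have d01 : R ≤ R - r₁ ∧ R - r₁ ≤ R + 1 := ⟨by linarith, by linarith⟩
  have d02 : R ≤ R - r₂ ∧ R - r₂ ≤ R + 2 := ⟨by linarith, by linarith⟩
  have hs : |r₁ + r₂| ≤ 3 := by rw [abs_le]; constructor <;> linarith
  have hr : |r₁| ≤ 1 := by rw [abs_le]; constructor <;> linarith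
  generalize hp₀ : x + y * R + z * R ^ 2 = p₀
  generalize hp₁ : x + y * r₁ + z * r₁ ^ 2 = p₁
  generalize hp₂ : x + y * r₂ + z * r₂ ^ 2 = p₂
  refine ⟨?_, ?_, ?_⟩
  · have key : z * ((R - r₁) * (R - r₂) * (r₁ - r₂)) =
        p₀ * (r₁ - r₂) - p₁ * (R - r₂) + p₂ * (R - r₁) := by
      rw [← hp₀, ← hp₁, ← hp₂]; ring
    have hD : R ^ 2 ≤ (R - r₁) * (R - r₂) * (r₁ - r₂) := by
      nlinarith [mul_le_mul d01.1 d02.1 hR0.le (hR0.le.trans d01.1)]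
    calc |z| * R ^ 2 ≤ |z| * ((R - r₁) * (R - r₂) * (r₁ - r₂)) := by gcongr
      _ = |p₀ * (r₁ - r₂) - p₁ * (R - r₂) + p₂ * (R - r₁)| := by
        rw [← key, abs_mul, abs_of_nonneg ((sq_nonneg R).trans hD)]
      _ ≤ |p₀ * (r₁ - r₂)| + |p₁ * (R - r₂)| + |p₂ * (R - r₁)| :=
        (abs_add_le _ _).trans (by gcongr; exact abs_sub _ _)
      _ = (r₁ - r₂) * |p₀| + (R - r₂) * |p₁| + (R - r₁) * |p₂| := by
        rw [abs_mul, abs_mul, abs_mul, abs_of_nonneg (by linarith : 0 ≤ r₁ - r₂),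
          abs_of_nonneg (by linarith : 0 ≤ R - r₂), abs_of_nonneg (by linarith : 0 ≤ R - r₁)]
        ring
      _ ≤ 2 * |p₀| + (R + 2) * |p₁| + (R + 1) * |p₂| := by
        gcongr
        exacts [d12.2, d02.2, d01.2]
  · have key : (r₁ - r₂) * (y + z * (r₁ + r₂)) = p₁ - p₂ := by rw [← hp₁, ← hp₂]; ring
    have h1 : |y + z * (r₁ + r₂)| ≤ |p₁| + |p₂| := by
      calc |y + z * (r₁ + r₂)| ≤ (r₁ - r₂) * |y + z * (r₁ + r₂)| :=
            le_mul_of_one_le_left (abs_nonneg _) d12.1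
        _ = |p₁ - p₂| := by rw [← key, abs_mul, abs_of_nonneg (by linarith : 0 ≤ r₁ - r₂)]
        _ ≤ _ := abs_sub _ _
    have h2 : |z * (r₁ + r₂)| ≤ 3 * |z| := by
      rw [abs_mul, mul_comm]; gcongr
    have h3 := abs_sub (y + z * (r₁ + r₂)) (z * (r₁ + r₂))
    rw [add_sub_cancel_right] at h3
    linarith
  · have e : x = p₁ - (y * r₁ + z * r₁ ^ 2) := by rw [← hp₁]; ring
    have h1 : |y * r₁| ≤ |y| := by
      rw [abs_mul]; exact mul_le_of_le_one_right (abs_nonneg _) hr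
    have h2 : |z * r₁ ^ 2| ≤ |z| := by
      rw [abs_mul, abs_pow]
      exact mul_le_of_le_one_right (abs_nonneg _) (pow_le_one₀ (abs_nonneg _) hr)
    calc |x| = |p₁ - (y * r₁ + z * r₁ ^ 2)| := by rw [← e]
      _ ≤ |p₁| + |y * r₁ + z * r₁ ^ 2| := abs_sub _ _
      _ ≤ |p₁| + (|y * r₁| + |z * r₁ ^ 2|) := by gcongr; exact abs_add_le _ _
      _ ≤ _ := by linarith

theorem coordinates_bounds {a : ℤ} (ha : 0 ≤ a) (h : IsMonogenic a) (x y z : ℤ) :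
    |(z : ℝ)| * rho a ^ 2 ≤ 2 * |φ₀ ha h (elt a x y z)| +
      (rho a + 2) * |φ₁ ha h (elt a x y z)| + (rho a + 1) * |φ₂ ha h (elt a x y z)| ∧
    |(y : ℝ)| ≤ |φ₁ ha h (elt a x y z)| + |φ₂ ha h (elt a x y z)| + 3 * |(z : ℝ)| ∧
    |(x : ℝ)| ≤ |φ₁ ha h (elt a x y z)| + |(y : ℝ)| + |(z : ℝ)| := by
  rw [φ₀_elt, φ₁_elt, φ₂_elt]
  refine interpolation_bounds ?_ rfl rfl
  have := (rho_bounds ha).1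
  have ha' : (0 : ℝ) ≤ a := by exact_mod_cast ha
  linarith

/-- A bound for the exceptional coefficients in `exists_associate_small`. -/
@[irreducible] def coeffBound : ℤ := 20000000

/-- An element of norm at most `2a²` has an associate which is either of the form `x + yρ`
with `x, y` at most `a/20`, or has coordinates bounded by an absolute constant. -/
theorem exists_associate_small {a : ℤ} (ha : 2 ≤ a) (h : IsMonogenic a)
    {α : 𝓞 (CubicField a)} (hα : α ≠ 0) (hN : |(Algebra.norm ℤ α : ℝ)| ≤ 2 * a ^ 2) :
    ∃ (u : (𝓞 (CubicField a))ˣ) (x y z : ℤ), u * α = elt a x y z ∧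
      ((z = 0 ∧ 20 * |x| ≤ a ∧ 20 * |y| ≤ a) ∨
        (|x| ≤ coeffBound ∧ |y| ≤ coeffBound ∧ |z| ≤ coeffBound)) := by
  have ha0 : 0 ≤ a := by omega
  have haR : (2 : ℝ) ≤ a := by exact_mod_cast ha
  obtain ⟨hR1, hR2⟩ := rho_bounds ha0
  -- θ is small enough that a first conjugate of at most ρ²/400 forces |z| < 1 and then 20|x|, 20|y|
  -- ≤ a.
  obtain ⟨u, ⟨b1, b2⟩, b3, b4⟩ := exists_unit_reduce ha0 h (θ := 1 / 400) (by norm_num) hα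
  obtain ⟨x, y, z, he⟩ := exists_eq_elt h (u * α)
  refine ⟨u, x, y, z, he, ?_⟩
  have hN' : |φ₀ ha0 h (u * α)| * |φ₁ ha0 h (u * α)| * |φ₂ ha0 h (u * α)| ≤ 2 * rho a ^ 2 := by
    have hu : |(Algebra.norm ℤ ((u : 𝓞 (CubicField a)) * α) : ℝ)| = |(Algebra.norm ℤ α : ℝ)| := by
      rw [map_mul]
      push_cast
      rw [abs_mul]
      rcases Int.isUnit_iff.1 (u.isUnit.map (Algebra.norm ℤ)) with h | h <;> simp [h]
    rw [← abs_mul, ← abs_mul, ← norm_eq_prod, hu]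
    refine hN.trans ?_
    gcongr
    linarith
  rw [he] at b1 b2 b3 b4 hN'
  obtain ⟨c1, c2, c3⟩ := coordinates_bounds ha0 h x y z
  generalize |φ₀ ha0 h (elt a x y z)| = p₀ at *
  generalize |φ₁ ha0 h (elt a x y z)| = p₁ at *
  generalize |φ₂ ha0 h (elt a x y z)| = p₂ at *
  generalize rho a = R at *
  have hRp : 0 < R := by linarith
  rcases le_or_gt p₀ (1 / 400 * R ^ 2) with hp | hp
  · left
    have hz : z = 0 := by
      have : |(z : ℝ)| * R ^ 2 < 1 * R ^ 2 := by nlinarith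
      have := lt_of_mul_lt_mul_right this (by positivity)
      rw [← Int.abs_lt_one_iff]
      exact_mod_cast this
    subst hz
    simp only [Int.cast_zero, abs_zero, mul_zero, add_zero] at c1 c2 c3
    refine ⟨rfl, ?_, ?_⟩
    · have : 20 * |(x : ℝ)| ≤ a := by linarith
      exact_mod_cast this
    · have : 20 * |(y : ℝ)| ≤ a := by linarith
      exact_mod_cast this
  · right
    have hp₀ : 0 < p₀ := lt_trans (by positivity) hp
    -- A large p₀ leaves p₁p₂ bounded; the lower ends of the windows then bound p₁, p₂ and p₀/R²
    -- separately.
    have h12 : p₁ * p₂ ≤ 800 := by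
      by_contra! hlt
      have : 1 / 400 * R ^ 2 * 800 < p₀ * (p₁ * p₂) := by gcongr
      linarith
    have hp₁ : p₁ ≤ 640000 := by nlinarith
    have hp₂ : p₂ ≤ 320000 := by nlinarith
    have hp0 : p₀ ≤ 640000 * R ^ 2 := by
      have : p₀ * (1 / 400 * (1 / 400 / 2)) ≤ p₀ * (p₁ * p₂) := by gcongr
      linarith
    have hz : |(z : ℝ)| ≤ 4000000 := by
      refine le_of_mul_le_mul_right (a := R ^ 2) ?_ (by positivity)
      nlinarith
    rw [coeffBound]
    refine ⟨?_, ?_, ?_⟩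
    · have : |(x : ℝ)| ≤ 20000000 := by linarith
      exact_mod_cast this
    · have : |(y : ℝ)| ≤ 20000000 := by linarith
      exact_mod_cast this
    · have : |(z : ℝ)| ≤ 20000000 := by linarith
      exact_mod_cast this

/-! ### Integer points with |xy(x - y)| bounded. -/

/-- Pairs of positive integers with `p ≤ 3q` and `pq² ≤ Q³`. -/
def cuspPairs (Q : ℕ) : Finset (Σ _ : ℕ, ℕ) :=
  (Finset.Icc 1 Q).sigma (fun q => Finset.Icc 1 (3 * q)) ∪
    (Finset.Ioc Q (Q ^ 3)).sigma (fun q => Finset.Icc 1 (Q ^ 3 / q ^ 2))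

theorem mem_cuspPairs {Q p q : ℕ} (hp : 1 ≤ p) (hq : 1 ≤ q) (h3 : p ≤ 3 * q)
    (h : p * q ^ 2 ≤ Q ^ 3) : (⟨q, p⟩ : Σ _ : ℕ, ℕ) ∈ cuspPairs Q := by
  have hqQ : q ≤ Q ^ 3 := by nlinarith
  have hpq : p ≤ Q ^ 3 / q ^ 2 := (Nat.le_div_iff_mul_le (by positivity)).2 h
  simp only [cuspPairs, Finset.mem_union, Finset.mem_sigma, Finset.mem_Icc, Finset.mem_Ioc]
  omega

/-- For q ≤ Q the condition p ≤ 3q gives at most 3Q² pairs. Beyond Q the cusp contributes at most Q³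
∑ 1/q² ≤ Q³/Q. -/
theorem card_cuspPairs_le {Q : ℕ} (hQ : 1 ≤ Q) : (cuspPairs Q).card ≤ 4 * Q ^ 2 := by
  have h1 : ((Finset.Icc 1 Q).sigma (fun q => Finset.Icc 1 (3 * q))).card ≤ 3 * Q ^ 2 := by
    rw [Finset.card_sigma]
    calc ∑ q ∈ Finset.Icc 1 Q, (Finset.Icc 1 (3 * q)).card ≤ ∑ q ∈ Finset.Icc 1 Q, 3 * Q := by
          refine Finset.sum_le_sum fun q hq => ?_
          have := (Finset.mem_Icc.1 hq).2
          simp only [Nat.card_Icc]; omega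
      _ = 3 * Q ^ 2 := by simp; ring
  have h2 : (((Finset.Ioc Q (Q ^ 3)).sigma (fun q => Finset.Icc 1 (Q ^ 3 / q ^ 2))).card) ≤
      Q ^ 2 := by
    rw [Finset.card_sigma]
    have hQ0 : (0 : ℝ) < Q := by exact_mod_cast hQ
    have hle : Q ≤ Q ^ 3 := Nat.le_self_pow (by norm_num) Q
    have hs := sum_Ioc_inv_sq_le_sub (α := ℝ) (by omega : Q ≠ 0) hle
    have : ((∑ q ∈ Finset.Ioc Q (Q ^ 3), (Finset.Icc 1 (Q ^ 3 / q ^ 2)).card : ℕ) : ℝ) ≤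
        (Q : ℝ) ^ 2 := by
      push_cast
      calc ∑ q ∈ Finset.Ioc Q (Q ^ 3), ((Finset.Icc 1 (Q ^ 3 / q ^ 2)).card : ℝ)
          ≤ ∑ q ∈ Finset.Ioc Q (Q ^ 3), (Q : ℝ) ^ 3 * ((q : ℝ) ^ 2)⁻¹ := by
            refine Finset.sum_le_sum fun q _ => ?_
            simp only [Nat.card_Icc, Nat.add_sub_cancel]
            refine Nat.cast_div_le.trans ?_
            push_cast
            rw [div_eq_mul_inv]
        _ = (Q : ℝ) ^ 3 * ∑ q ∈ Finset.Ioc Q (Q ^ 3), ((q : ℝ) ^ 2)⁻¹ := by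
            rw [Finset.mul_sum]
        _ ≤ (Q : ℝ) ^ 3 * (Q : ℝ)⁻¹ := by
            gcongr
            refine hs.trans (sub_le_self _ (by positivity))
        _ = (Q : ℝ) ^ 2 := by field_simp
    exact_mod_cast this
  calc (cuspPairs Q).card ≤ _ := Finset.card_union_le _ _
    _ ≤ 4 * Q ^ 2 := by omega

/-- The pairs of nonzero integers with `|p| ≤ 3|q|` and `|p|q² ≤ Q³`. -/
def signedCuspPairs (Q : ℕ) : Finset (ℤ × ℤ) :=
  (cuspPairs Q ×ˢ (({1, -1} : Finset ℤ) ×ˢ ({1, -1} : Finset ℤ))).image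
    fun t => (t.2.1 * t.1.2, t.2.2 * t.1.1)

theorem mem_signedCuspPairs {Q : ℕ} {p q : ℤ} (hp : p ≠ 0) (hq : q ≠ 0) (h3 : |p| ≤ 3 * |q|)
    (h : |p| * q ^ 2 ≤ Q ^ 3) : (p, q) ∈ signedCuspPairs Q := by
  have hsgn : ∀ n : ℤ, n ≠ 0 → n.sign ∈ ({1, -1} : Finset ℤ) := fun n hn => by
    rcases lt_or_gt_of_ne hn with h | h
    · simp [Int.sign_eq_neg_one_of_neg h]
    · simp [Int.sign_eq_one_of_pos h]
  refine Finset.mem_image.2 ⟨(⟨q.natAbs, p.natAbs⟩, (p.sign, q.sign)), ?_, ?_⟩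
  · refine Finset.mem_product.2 ⟨mem_cuspPairs ?_ ?_ ?_ ?_, Finset.mem_product.2 ⟨?_, ?_⟩⟩
    · omega
    · omega
    · zify
      exact h3
    · zify
      rwa [sq_abs]
    · exact hsgn p hp
    · exact hsgn q hq
  · exact Prod.ext (Int.sign_mul_natAbs p) (Int.sign_mul_natAbs q)

theorem card_signedCuspPairs_le {Q : ℕ} (hQ : 1 ≤ Q) :
    (signedCuspPairs Q).card ≤ 16 * Q ^ 2 := by
  refine Finset.card_image_le.trans ?_
  have := card_cuspPairs_le hQ
  simp only [Finset.card_product]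
  have h2 : ({1, -1} : Finset ℤ).card = 2 := rfl
  rw [h2]
  omega

/-- A finite set containing all `(x, y)` with `0 < 2|xy(x-y)| ≤ Q³`. -/
def thuePairs (Q : ℕ) : Finset (ℤ × ℤ) :=
  signedCuspPairs Q ∪ (signedCuspPairs Q).image Prod.swap ∪
    (signedCuspPairs Q).image (fun t => (t.2, t.2 - t.1))

theorem card_thuePairs_le {Q : ℕ} (hQ : 1 ≤ Q) : (thuePairs Q).card ≤ 48 * Q ^ 2 := by
  have h := card_signedCuspPairs_le hQ
  have h1 := Finset.card_union_le (signedCuspPairs Q ∪ (signedCuspPairs Q).image Prod.swap)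
    ((signedCuspPairs Q).image (fun t => (t.2, t.2 - t.1)))
  have h2 := Finset.card_union_le (signedCuspPairs Q) ((signedCuspPairs Q).image Prod.swap)
  have h3 := Finset.card_image_le (s := signedCuspPairs Q) (f := Prod.swap)
  have h4 := Finset.card_image_le (s := signedCuspPairs Q) (f := fun t => (t.2, t.2 - t.1))
  rw [thuePairs]
  omega

/-- The region has cusps along x = 0, y = 0 and x = y. If |y| ≥ 2|x| then |x - y| ≥ |y|/2, so |x|y²
≤ Q³; the case |x| ≥ 2|y| is symmetric. Otherwise |x - y| ≤ 3|x| and |x| ≤ 2|y|, and (x - y, x)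
plays the role of (p, q). -/
theorem mem_thuePairs {Q : ℕ} {x y : ℤ} (h0 : x * y * (x - y) ≠ 0)
    (h : 2 * |x * y * (x - y)| ≤ Q ^ 3) : (x, y) ∈ thuePairs Q := by
  obtain ⟨⟨hx, hy⟩, hxy⟩ : (x ≠ 0 ∧ y ≠ 0) ∧ x - y ≠ 0 := by simpa [not_or] using h0
  rw [abs_mul, abs_mul] at h
  simp only [thuePairs, Finset.mem_union, Finset.mem_image]
  have ax := abs_pos.2 hx
  have ay := abs_pos.2 hy
  have aw := abs_pos.2 hxy
  have t1 := abs_sub_abs_le_abs_sub x y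
  have t2 := abs_sub_abs_le_abs_sub y x
  rw [abs_sub_comm y x] at t2
  have t3 := abs_sub x y
  rcases le_or_gt (2 * |x|) |y| with h1 | h1
  · refine Or.inl (Or.inl (mem_signedCuspPairs hx hy (by linarith) (le_trans ?_ h)))
    rw [← sq_abs y]
    have : |x| * |y| * |y| ≤ |x| * |y| * (2 * |x - y|) := by gcongr; linarith
    nlinarith
  rcases le_or_gt (2 * |y|) |x| with h2 | h2
  · refine Or.inl (Or.inr ⟨(y, x),
      mem_signedCuspPairs hy hx (by linarith) (le_trans ?_ h), rfl⟩)
    rw [← sq_abs x]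
    have : |x| * |y| * |x| ≤ |x| * |y| * (2 * |x - y|) := by gcongr; linarith
    nlinarith
  · refine Or.inr ⟨(x - y, x),
      mem_signedCuspPairs hxy hx (by linarith) (le_trans ?_ h), by simp⟩
    rw [← sq_abs x]
    have : |x - y| * |x| * |x| ≤ |x - y| * |x| * (2 * |y|) := by gcongr
    nlinarith

/-- When `x, y` are small compared to `a` the norm of `x + yρ` is dominated by `a xy(x-y)`. -/
theorem le_abs_norm_form {a x y : ℤ} (hx : 20 * |x| ≤ a) (hy : 20 * |y| ≤ a)
    (h0 : x * y * (x - y) ≠ 0) :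
    a * |x * y * (x - y)| ≤ 2 * |a * (x * y * (x - y)) + (x ^ 3 - 3 * x * y ^ 2 + y ^ 3)| := by
  obtain ⟨⟨hx0, hy0⟩, hxy⟩ : (x ≠ 0 ∧ y ≠ 0) ∧ x - y ≠ 0 := by simpa [not_or] using h0
  have ax := abs_pos.2 hx0
  have ay := abs_pos.2 hy0
  have aw := abs_pos.2 hxy
  have ha : 0 ≤ a := by linarith
  have t1 := abs_sub_abs_le_abs_sub x y
  have t2 := abs_sub_abs_le_abs_sub y x
  rw [abs_sub_comm y x] at t2
  have t3 := abs_sub x y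
  have hP : |x * y * (x - y)| = |x| * |y| * |x - y| := by rw [abs_mul, abs_mul]
  have hE : |x ^ 3 - 3 * x * y ^ 2 + y ^ 3| ≤ |x| ^ 3 + 3 * |x| * |y| ^ 2 + |y| ^ 3 := by
    calc |x ^ 3 - 3 * x * y ^ 2 + y ^ 3| ≤ |x ^ 3 - 3 * x * y ^ 2| + |y ^ 3| := abs_add_le _ _
      _ ≤ |x ^ 3| + |3 * x * y ^ 2| + |y ^ 3| := by gcongr; exact abs_sub _ _
      _ = _ := by simp [abs_mul, abs_pow]
  -- Here q ≤ p + w ≤ 2pw, so twice the error is at most 10q³ ≤ 20q·pqw. This fixes the constant 20.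
  have hm : ∀ p q w : ℤ, 1 ≤ p → 1 ≤ q → 1 ≤ w → p ≤ q → q ≤ p + w → 20 * q ≤ a →
      2 * (p ^ 3 + 3 * p * q ^ 2 + q ^ 3) ≤ a * (p * q * w) ∧
      2 * (q ^ 3 + 3 * q * p ^ 2 + p ^ 3) ≤ a * (p * q * w) := by
    intro p q w hp hq hw hpq hqw hqa
    have e1 : q ≤ 2 * (p * w) := by nlinarith
    have e2 : q ^ 3 ≤ 2 * (p * q * w) * q := by nlinarith [mul_le_mul_of_nonneg_right e1 (sq_nonneg q)]
    have e3 : 20 * q * (p * q * w) ≤ a * (p * q * w) := by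
      gcongr
    have e4 : p ^ 3 ≤ q ^ 3 := by gcongr
    have e5 : p * q ^ 2 ≤ q ^ 3 := by nlinarith [mul_le_mul_of_nonneg_right hpq (sq_nonneg q)]
    have e6 : q * p ^ 2 ≤ q ^ 3 := by nlinarith [pow_le_pow_left₀ (by linarith : 0 ≤ p) hpq 2]
    constructor <;> nlinarith
  have hlow : 2 * (|x| ^ 3 + 3 * |x| * |y| ^ 2 + |y| ^ 3) ≤ a * (|x| * |y| * |x - y|) := by
    rcases le_total |x| |y| with hle | hle
    · exact (hm |x| |y| |x - y| ax ay aw hle (by linarith) hy).1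
    · have := (hm |y| |x| |x - y| ay ax aw hle (by linarith) hx).2
      linarith [mul_comm |x| |y|, congrArg (fun t => a * (t * |x - y|)) (mul_comm |x| |y|)]
  have hsub := abs_sub_abs_le_abs_sub (a * (x * y * (x - y)))
    (-(x ^ 3 - 3 * x * y ^ 2 + y ^ 3))
  rw [abs_neg, sub_neg_eq_add, abs_mul, abs_of_nonneg ha] at hsub
  rw [hP] at *
  linarith

/-! ### The upper bound. -/

theorem elt_dvd {a n x y z : ℤ} (hx : n ∣ x) (hy : n ∣ y) (hz : n ∣ z) :
    (n : 𝓞 (CubicField a)) ∣ elt a x y z := by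
  obtain ⟨x, rfl⟩ := hx
  obtain ⟨y, rfl⟩ := hy
  obtain ⟨z, rfl⟩ := hz
  exact ⟨elt a x y z, by simp only [elt]; push_cast; ring⟩

theorem isPrimitive_span_iff {R : Type*} [CommRing R] [IsDedekindDomain R] (α : R) :
    IsPrimitive (Ideal.span {α}) ↔ ∀ n : ℕ, 2 ≤ n → ¬ (n : R) ∣ α := by
  simp only [IsPrimitive, Ideal.dvd_span_singleton, Ideal.mem_span_singleton]

/-- The coefficient vectors with entries of absolute value at most `B`. -/
noncomputable def coeffBox (B : ℤ) : Finset (ℤ × ℤ × ℤ) :=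
  Finset.Icc (-B) B ×ˢ Finset.Icc (-B) B ×ˢ Finset.Icc (-B) B

theorem mem_coeffBox {B x y z : ℤ} :
    (x, y, z) ∈ coeffBox B ↔ |x| ≤ B ∧ |y| ≤ B ∧ |z| ≤ B := by
  simp only [coeffBox, Finset.mem_product, Finset.mem_Icc, abs_le]

/-- The coefficient vectors of the generators in the upper bound. -/
noncomputable def generatorCoeffs (Q : ℕ) : Finset (ℤ × ℤ × ℤ) :=
  coeffBox coeffBound ∪ (thuePairs Q).image fun t => (t.1, t.2, 0)

theorem card_generatorCoeffs_le {Q : ℕ} (hQ : 1 ≤ Q) :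
    (generatorCoeffs Q).card ≤ (coeffBox coeffBound).card + 48 * Q ^ 2 := by
  rw [generatorCoeffs]
  have h1 := Finset.card_union_le (coeffBox coeffBound)
    ((thuePairs Q).image fun t => ((t.1, t.2, 0) : ℤ × ℤ × ℤ))
  have h2 := Finset.card_image_le (s := thuePairs Q)
    (f := fun t => ((t.1, t.2, 0) : ℤ × ℤ × ℤ))
  have h3 := card_thuePairs_le hQ
  generalize (coeffBox coeffBound).card = B at *
  omega

theorem exists_generator {a : ℤ} (ha : 2 ≤ a) (h : IsMonogenic a) {X : ℝ} (hX : X ≤ 2 * a ^ 2)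
    {Q : ℕ} (hQ : 4 * X ≤ a * Q ^ 3) {I : Ideal (𝓞 (CubicField a))}
    (hI : I ∈ primitivePrincipalIdeals a) (hIX : (Ideal.absNorm I : ℝ) ≤ X) :
    ∃ t ∈ generatorCoeffs Q, I = Ideal.span {elt a t.1 t.2.1 t.2.2} := by
  obtain ⟨hprim, ⟨α, hI⟩⟩ := hI
  obtain rfl : I = Ideal.span {α} := hI
  have hα : α ≠ 0 := by
    rintro rfl
    exact (isPrimitive_span_iff 0).1 hprim 2 le_rfl (dvd_zero _)
  have hnorm : ∀ β : 𝓞 (CubicField a), (Ideal.absNorm (Ideal.span {β}) : ℝ) =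
      |(Algebra.norm ℤ β : ℝ)| := fun β => by
    rw [Ideal.absNorm_span_singleton, Nat.cast_natAbs, Int.cast_abs]
  obtain ⟨u, x, y, z, he, hxyz⟩ := exists_associate_small ha h hα
    (by rw [← hnorm]; exact hIX.trans hX)
  have hspan : Ideal.span {α} = Ideal.span {elt a x y z} := by
    rw [← he]
    exact (Ideal.span_singleton_mul_left_unit u.isUnit α).symm
  rw [hspan] at hprim hIX
  suffices hmem : (x, y, z) ∈ generatorCoeffs Q from ⟨_, hmem, hspan⟩
  simp only [generatorCoeffs, Finset.mem_union, Finset.mem_image, mem_coeffBox]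
  rcases hxyz with ⟨rfl, hx, hy⟩ | hxyz
  swap
  · exact Or.inl hxyz
  -- On these three lines the main term of the norm vanishes, but primitivity makes gcd(x, y) = 1
  -- and so |x|, |y| ≤ 1, inside the bounded box.
  by_cases h0 : x * y * (x - y) = 0
  · left
    have hgcd : Int.gcd x y ≤ 1 := by
      by_contra! hlt
      exact (isPrimitive_span_iff _).1 hprim _ hlt (by
        have := elt_dvd (a := a) (Int.gcd_dvd_left x y) (Int.gcd_dvd_right x y)
          (dvd_zero (Int.gcd x y : ℤ))
        simpa using this)
    have : x.natAbs ≤ 1 ∧ y.natAbs ≤ 1 := by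
      rcases mul_eq_zero.1 h0 with h0 | h0
      · rcases mul_eq_zero.1 h0 with rfl | rfl
        · rw [Int.gcd_zero_left] at hgcd; exact ⟨by simp, hgcd⟩
        · rw [Int.gcd_zero_right] at hgcd; exact ⟨hgcd, by simp⟩
      · obtain rfl : x = y := by omega
        rw [Int.gcd_self] at hgcd; exact ⟨hgcd, hgcd⟩
    have hB : (1 : ℤ) ≤ coeffBound := by rw [coeffBound]; norm_num
    simp only [Int.abs_eq_natAbs]
    omega
  · right
    refine ⟨(x, y), mem_thuePairs h0 ?_, rfl⟩
    have h1 := le_abs_norm_form hx hy h0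
    rw [hnorm, norm_elt h, ← Int.cast_abs] at hIX
    have h2 : ((a * |x * y * (x - y)| : ℤ) : ℝ) ≤ 2 * X :=
      (Int.cast_le.2 h1).trans (by rw [Int.cast_mul]; push_cast at hIX ⊢; linarith)
    have ha' : (0 : ℝ) < a := by exact_mod_cast (by omega : 0 < a)
    have h3 : ((2 * |x * y * (x - y)| : ℤ) : ℝ) ≤ ((Q ^ 3 : ℤ) : ℝ) := by
      refine le_of_mul_le_mul_left (a := (a : ℝ)) ?_ ha'
      push_cast at h2 ⊢
      linarith
    exact Int.cast_le.1 h3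

/-- Upper bound for the number of primitive principal ideals of norm at most `X`. -/
theorem count_le {a : ℤ} (ha : 2 ≤ a) (h : IsMonogenic a) {X : ℝ} (hX₁ : a ≤ X)
    (hX : X ≤ 2 * a ^ 2) :
    (count a X : ℝ) ≤ ((coeffBox coeffBound).card + 1000) * (X / a) ^ (2 / 3 : ℝ) := by
  have ha' : (0 : ℝ) < a := by exact_mod_cast (by omega : 0 < a)
  have hX0 : 0 < X := ha'.trans_le hX₁
  obtain ⟨s, hs⟩ : ∃ s : ℝ, s = (X / a) ^ (1 / 3 : ℝ) := ⟨_, rfl⟩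
  have hXa : 1 ≤ X / a := by rwa [one_le_div ha']
  have hs1 : 1 ≤ s := by rw [hs]; exact Real.one_le_rpow hXa (by norm_num)
  have hs3 : s ^ 3 = X / a := by
    rw [hs, ← Real.rpow_natCast, ← Real.rpow_mul (by positivity)]; norm_num
  have hs2 : s ^ 2 = (X / a) ^ (2 / 3 : ℝ) := by
    rw [hs, ← Real.rpow_natCast, ← Real.rpow_mul (by positivity)]; norm_num
  -- The factor 4 is 2 from comparing the norm with its main term times 2 from `mem_thuePairs`.
  have hQ : 4 * X ≤ a * (⌈2 * s⌉₊ : ℝ) ^ 3 := by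
    have h1 : (2 * s) ^ 3 ≤ (⌈2 * s⌉₊ : ℝ) ^ 3 := by
      gcongr
      exact Nat.le_ceil _
    have h2 : a * (2 * s) ^ 3 = 8 * X := by rw [mul_pow, hs3]; field_simp; norm_num
    have h3 : (a : ℝ) * (2 * s) ^ 3 ≤ a * (⌈2 * s⌉₊ : ℝ) ^ 3 := by gcongr
    linarith
  have hQ1 : 1 ≤ ⌈2 * s⌉₊ := Nat.one_le_ceil_iff.2 (by linarith)
  have hQ3 : (⌈2 * s⌉₊ : ℝ) ≤ 3 * s := by
    have := (Nat.ceil_lt_add_one (show 0 ≤ 2 * s by linarith)).le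
    linarith
  have hsub : {I ∈ primitivePrincipalIdeals a | (Ideal.absNorm I : ℝ) ≤ X} ⊆
      (((generatorCoeffs ⌈2 * s⌉₊).image fun t => Ideal.span {elt a t.1 t.2.1 t.2.2} :
        Finset (Ideal (𝓞 (CubicField a)))) : Set (Ideal (𝓞 (CubicField a)))) := by
    rintro I ⟨hI, hIX⟩
    obtain ⟨t, ht, rfl⟩ := exists_generator ha h hX hQ hI hIX
    exact Finset.mem_coe.2 (Finset.mem_image_of_mem _ ht)
  have hcard : count a X ≤ (coeffBox coeffBound).card + 48 * ⌈2 * s⌉₊ ^ 2 := by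
    refine (Set.ncard_le_ncard hsub (Finset.finite_toSet _)).trans ?_
    rw [Set.ncard_coe_finset]
    exact Finset.card_image_le.trans (card_generatorCoeffs_le hQ1)
  have hcard' : (count a X : ℝ) ≤ (coeffBox coeffBound).card + 48 * (⌈2 * s⌉₊ : ℝ) ^ 2 := by
    exact_mod_cast hcard
  rw [← hs2]
  have h5 : (0 : ℝ) ≤ (coeffBox coeffBound).card := Nat.cast_nonneg _
  have h4 : (⌈2 * s⌉₊ : ℝ) ^ 2 ≤ (3 * s) ^ 2 := by gcongr
  have h6 : ((coeffBox coeffBound).card : ℝ) ≤ (coeffBox coeffBound).card * s ^ 2 :=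
    le_mul_of_one_le_right h5 (one_le_pow₀ hs1)
  have h7 := sq_nonneg s
  linarith

theorem exists_count_le : ∃ K : ℝ, 0 < K ∧ ∀ a : ℤ, 2 ≤ a → IsMonogenic a →
    ∀ X : ℝ, a ≤ X → X ≤ 2 * a ^ 2 → (count a X : ℝ) ≤ K * (X / a) ^ (2 / 3 : ℝ) :=
  ⟨_, by positivity, fun _ ha h _ hX₁ hX => count_le ha h hX₁ hX⟩

/-! ### Counting coprime pairs. -/

/-- The coprime pairs of positive integers up to `T`. -/
def coprimePairs (T : ℕ) : Finset (ℕ × ℕ) :=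
  (Finset.Ioc 0 T ×ˢ Finset.Ioc 0 T).filter fun t => Nat.Coprime t.1 t.2

/-- The pairs of positive multiples of `d` up to `T`. -/
def multiplePairs (T d : ℕ) : Finset (ℕ × ℕ) :=
  (Finset.Ioc 0 T).filter (d ∣ ·) ×ˢ (Finset.Ioc 0 T).filter (d ∣ ·)

theorem card_multiplePairs (T d : ℕ) : (multiplePairs T d).card = (T / d) ^ 2 := by
  rw [multiplePairs, Finset.card_product, Nat.Ioc_filter_dvd_card_eq_div, sq]

theorem sum_inv_mul_succ_le_one (n : ℕ) :
    ∑ k ∈ Finset.range n, (1 : ℝ) / ((k + 1) * (k + 2)) = 1 - 1 / (n + 1) := by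
  induction n with
  | zero => simp
  | succ n ih =>
    rw [Finset.sum_range_succ, ih]
    push_cast
    field_simp
    ring

/-- A non-coprime pair has a common divisor 2 or 2k + 3. The first accounts for at most T²/4 pairs,
and so do the others together, since (2k + 3)² ≥ 4(k + 1)(k + 2) makes the sum telescope. -/
theorem sq_le_two_mul_card_coprimePairs (T : ℕ) : T ^ 2 ≤ 2 * (coprimePairs T).card := by
  have hcover : Finset.Ioc 0 T ×ˢ Finset.Ioc 0 T ⊆ coprimePairs T ∪ (multiplePairs T 2 ∪
      (Finset.range T).biUnion fun k => multiplePairs T (2 * k + 3)) := by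
    rintro ⟨m, n⟩ hmn
    obtain ⟨hm, hn⟩ := Finset.mem_product.1 hmn
    by_cases hc : Nat.Coprime m n
    · exact Finset.mem_union_left _ (Finset.mem_filter.2 ⟨hmn, hc⟩)
    refine Finset.mem_union_right _ ?_
    obtain ⟨p, hp, hpm, hpn⟩ := Nat.Prime.not_coprime_iff_dvd.1 hc
    have hmem : (m, n) ∈ multiplePairs T p :=
      Finset.mem_product.2 ⟨Finset.mem_filter.2 ⟨hm, hpm⟩, Finset.mem_filter.2 ⟨hn, hpn⟩⟩
    rcases hp.eq_two_or_odd with rfl | hodd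
    · exact Finset.mem_union_left _ hmem
    · refine Finset.mem_union_right _ (Finset.mem_biUnion.2 ⟨(p - 3) / 2, ?_, ?_⟩)
      · have h1 := Nat.le_of_dvd (Finset.mem_Ioc.1 hm).1 hpm
        have h2 := (Finset.mem_Ioc.1 hm).2
        have h3 := hp.two_le
        simp only [Finset.mem_range]
        omega
      · have h3 := hp.two_le
        rwa [show 2 * ((p - 3) / 2) + 3 = p by omega]
  have hcard := Finset.card_le_card hcover
  have hu1 := Finset.card_union_le (coprimePairs T) (multiplePairs T 2 ∪
      (Finset.range T).biUnion fun k => multiplePairs T (2 * k + 3))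
  have hu2 := Finset.card_union_le (multiplePairs T 2)
      ((Finset.range T).biUnion fun k => multiplePairs T (2 * k + 3))
  have hu3 : ((Finset.range T).biUnion fun k => multiplePairs T (2 * k + 3)).card ≤
      ∑ k ∈ Finset.range T, (T / (2 * k + 3)) ^ 2 :=
    Finset.card_biUnion_le.trans (Finset.sum_le_sum fun k _ => (card_multiplePairs _ _).le)
  rw [card_multiplePairs] at hu2
  rw [Finset.card_product, Nat.card_Ioc, Nat.sub_zero] at hcard
  have hodd : ((∑ k ∈ Finset.range T, (T / (2 * k + 3)) ^ 2 : ℕ) : ℝ) ≤ (T : ℝ) ^ 2 / 4 := by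
    push_cast
    calc ∑ k ∈ Finset.range T, ((T / (2 * k + 3) : ℕ) : ℝ) ^ 2
        ≤ ∑ k ∈ Finset.range T, (T : ℝ) ^ 2 / 4 * (1 / (((k : ℝ) + 1) * (k + 2))) := by
          refine Finset.sum_le_sum fun k _ => ?_
          have h1 : ((T / (2 * k + 3) : ℕ) : ℝ) ≤ T / (2 * k + 3) := by
            refine Nat.cast_div_le.trans (le_of_eq ?_)
            push_cast
            rfl
          calc ((T / (2 * k + 3) : ℕ) : ℝ) ^ 2 ≤ ((T : ℝ) / (2 * k + 3)) ^ 2 := by gcongr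
            _ = (T : ℝ) ^ 2 * (1 / (2 * k + 3) ^ 2) := by rw [div_pow]; ring
            _ ≤ (T : ℝ) ^ 2 * (1 / (4 * ((k + 1) * (k + 2)))) := by
              gcongr
              nlinarith
            _ = _ := by field_simp
      _ = (T : ℝ) ^ 2 / 4 * (1 - 1 / (T + 1)) := by
          rw [← Finset.mul_sum, sum_inv_mul_succ_le_one]
      _ ≤ (T : ℝ) ^ 2 / 4 * 1 := by
          gcongr
          have : (0 : ℝ) ≤ 1 / (T + 1) := by positivity
          linarith
      _ = _ := mul_one _
  have htwo : (((T / 2) ^ 2 : ℕ) : ℝ) ≤ (T : ℝ) ^ 2 / 4 := by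
    push_cast
    have h1 : ((T / 2 : ℕ) : ℝ) ≤ T / 2 := Nat.cast_div_le
    calc ((T / 2 : ℕ) : ℝ) ^ 2 ≤ ((T : ℝ) / 2) ^ 2 := by gcongr
      _ = _ := by ring
  have hall : T * T ≤ (coprimePairs T).card +
      ((T / 2) ^ 2 + ∑ k ∈ Finset.range T, (T / (2 * k + 3)) ^ 2) := by omega
  have hall' : (T : ℝ) * T ≤ (coprimePairs T).card + (((T / 2) ^ 2 : ℕ) +
      (∑ k ∈ Finset.range T, (T / (2 * k + 3)) ^ 2 : ℕ)) := by exact_mod_cast hall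
  have : (T : ℝ) ^ 2 ≤ 2 * (coprimePairs T).card := by nlinarith
  exact_mod_cast this

/-- The coprime pairs of integers in `(T/10, T]`. -/
def balancedPairs (T : ℕ) : Finset (ℕ × ℕ) :=
  (coprimePairs T).filter fun t => T < 10 * t.1 ∧ T < 10 * t.2

theorem mem_balancedPairs {T : ℕ} {t : ℕ × ℕ} : t ∈ balancedPairs T ↔
    (0 < t.1 ∧ t.1 ≤ T) ∧ (0 < t.2 ∧ t.2 ≤ T) ∧ Nat.Coprime t.1 t.2 ∧
      T < 10 * t.1 ∧ T < 10 * t.2 := by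
  simp only [balancedPairs, coprimePairs, Finset.mem_filter, Finset.mem_product, Finset.mem_Ioc]
  tauto

theorem three_mul_sq_le_card_balancedPairs (T : ℕ) :
    3 * T ^ 2 ≤ 10 * (balancedPairs T).card := by
  have hcover : coprimePairs T ⊆ balancedPairs T ∪
      (Finset.Ioc 0 (T / 10) ×ˢ Finset.Ioc 0 T ∪ Finset.Ioc 0 T ×ˢ Finset.Ioc 0 (T / 10)) := by
    intro t ht
    simp only [balancedPairs, coprimePairs, Finset.mem_filter, Finset.mem_product, Finset.mem_Ioc,
      Finset.mem_union] at ht ⊢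
    by_cases h1 : T < 10 * t.1
    · by_cases h2 : T < 10 * t.2
      · exact Or.inl ⟨ht, h1, h2⟩
      · right; right; omega
    · right; left; omega
  have h1 := Finset.card_le_card hcover
  have h2 := Finset.card_union_le (balancedPairs T)
    (Finset.Ioc 0 (T / 10) ×ˢ Finset.Ioc 0 T ∪ Finset.Ioc 0 T ×ˢ Finset.Ioc 0 (T / 10))
  have h3 := Finset.card_union_le (Finset.Ioc 0 (T / 10) ×ˢ Finset.Ioc 0 T)
    (Finset.Ioc 0 T ×ˢ Finset.Ioc 0 (T / 10))
  simp only [Finset.card_product, Nat.card_Ioc, Nat.sub_zero] at h3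
  have h4 := sq_le_two_mul_card_coprimePairs T
  have h5 : 10 * (T / 10 * T) ≤ T ^ 2 := by
    have := Nat.mul_div_le T 10
    nlinarith
  have h6 : T * (T / 10) = T / 10 * T := mul_comm _ _
  omega

/-! ### The lower bound. -/

section LowerBound

variable {a : ℤ} (ha : 100 ≤ a) (h : IsMonogenic a)

include ha h

omit ha in
theorem not_dvd_elt_of_coprime {m n : ℕ} (hmn : Nat.Coprime m n) (d : ℕ) (hd : 2 ≤ d) :
    ¬ (d : 𝓞 (CubicField a)) ∣ elt a (-m) n 0 := by
  rintro ⟨β, hβ⟩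
  obtain ⟨x, y, z, rfl⟩ := exists_eq_elt h β
  have he : (d : 𝓞 (CubicField a)) * elt a x y z = elt a (d * x) (d * y) (d * z) := by
    simp only [elt]; push_cast; ring
  rw [he, elt_inj h] at hβ
  have h1 : d ∣ m := by
    have : (d : ℤ) ∣ -(m : ℤ) := ⟨x, hβ.1⟩
    exact Int.natCast_dvd_natCast.1 ((dvd_neg).1 this)
  have h2 : d ∣ n := Int.natCast_dvd_natCast.1 ⟨y, hβ.2.1⟩
  have := Nat.dvd_gcd h1 h2
  rw [hmn] at this
  have := Nat.le_of_dvd one_pos this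
  omega

/-- With the signs -m, +n the terms at the two small conjugates of ρ, both negative, do not cancel;
at ρ itself nρ dominates because ρ > 100. -/
theorem embeddings_balanced {T m n : ℕ} (hm : 0 < m ∧ m ≤ T) (hn : 0 < n ∧ n ≤ T)
    (hTm : T < 10 * m) (hTn : T < 10 * n) :
    ((T * rho a / 20 ≤ |φ₀ (by omega : 0 ≤ a) h (elt a (-m) n 0)|) ∧
      |φ₀ (by omega : 0 ≤ a) h (elt a (-m) n 0)| ≤ T * rho a) ∧
    ((T / 10 : ℝ) ≤ |φ₁ (by omega : 0 ≤ a) h (elt a (-m) n 0)| ∧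
      |φ₁ (by omega : 0 ≤ a) h (elt a (-m) n 0)| ≤ 2 * T) ∧
    ((T / 10 : ℝ) ≤ |φ₂ (by omega : 0 ≤ a) h (elt a (-m) n 0)| ∧
      |φ₂ (by omega : 0 ≤ a) h (elt a (-m) n 0)| ≤ 3 * T) := by
  rw [φ₀_elt, φ₁_elt, φ₂_elt, rho₁, rho₂]
  have hR := (rho_bounds (by omega : 0 ≤ a)).1
  have haR : (100 : ℝ) ≤ a := by exact_mod_cast ha
  generalize rho a = R at *
  have hm1 : (0 : ℝ) < m := by exact_mod_cast hm.1
  have hm2 : (m : ℝ) ≤ T := by exact_mod_cast hm.2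
  have hm3 : (T : ℝ) ≤ 10 * m := by exact_mod_cast hTm.le
  have hn1 : (0 : ℝ) < n := by exact_mod_cast hn.1
  have hn2 : (n : ℝ) ≤ T := by exact_mod_cast hn.2
  have hn3 : (T : ℝ) ≤ 10 * n := by exact_mod_cast hTn.le
  have hR0 : 0 < R := by linarith
  have e0 : ((-m : ℤ) : ℝ) + ((n : ℤ) : ℝ) * R + ((0 : ℤ) : ℝ) * R ^ 2 = n * R - m := by
    push_cast; ring
  have e1 : ((-m : ℤ) : ℝ) + ((n : ℤ) : ℝ) * (-1 / (1 + R)) + ((0 : ℤ) : ℝ) * (-1 / (1 + R)) ^ 2 =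
      -(m + n * (1 + R)⁻¹) := by
    push_cast; ring
  have e2 : ((-m : ℤ) : ℝ) + ((n : ℤ) : ℝ) * (-(1 + R) / R) + ((0 : ℤ) : ℝ) * (-(1 + R) / R) ^ 2 =
      -(m + n * (1 + R⁻¹)) := by
    push_cast; field_simp; ring
  have i1 : 0 < (1 + R)⁻¹ ∧ (1 + R)⁻¹ ≤ 1 :=
    ⟨by positivity, inv_le_one_of_one_le₀ (by linarith)⟩
  have i2 : 0 < R⁻¹ ∧ R⁻¹ ≤ 1 := ⟨by positivity, inv_le_one_of_one_le₀ (by linarith)⟩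
  have k1 : n * (1 + R)⁻¹ ≤ n := mul_le_of_le_one_right hn1.le i1.2
  have k2 : n * R⁻¹ ≤ n := mul_le_of_le_one_right hn1.le i2.2
  have k3 : 0 < n * (1 + R)⁻¹ := mul_pos hn1 i1.1
  have k4 : 0 < n * R⁻¹ := mul_pos hn1 i2.1
  have k5 : (T : ℝ) * R ≤ 10 * n * R := by gcongr
  have k6 : (T : ℝ) * 100 ≤ T * R := by gcongr; linarith
  have k7 : n * R ≤ T * R := by gcongr
  rw [e0, e1, e2, abs_neg, abs_neg, abs_of_pos (by linarith : 0 < n * R - m),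
    abs_of_pos (by linarith : 0 < m + n * (1 + R)⁻¹),
    abs_of_pos (by nlinarith : 0 < m + n * (1 + R⁻¹)), mul_add, mul_one]
  refine ⟨⟨?_, ?_⟩, ⟨?_, ?_⟩, ?_, ?_⟩ <;> linarith

/-- Interpolation gives |z|ρ² = O(ρ), so z = 0; then y(ρ - ρ₁) is a difference of two conjugates, at
most 40 < ρ, so y = 0. The bounds 20, 20, 30 are the ratios of the ranges in `embeddings_balanced`.
-/
theorem eq_intCast_of_embeddings_le {β : 𝓞 (CubicField a)}
    (h0 : |φ₀ (by omega : 0 ≤ a) h β| ≤ 20) (h1 : |φ₁ (by omega : 0 ≤ a) h β| ≤ 20)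
    (h2 : |φ₂ (by omega : 0 ≤ a) h β| ≤ 30) : ∃ x : ℤ, β = x := by
  obtain ⟨x, y, z, rfl⟩ := exists_eq_elt h β
  have ha0 : 0 ≤ a := by omega
  obtain ⟨c1, -, -⟩ := coordinates_bounds ha0 h x y z
  have hR := (rho_bounds ha0).1
  have haR : (100 : ℝ) ≤ a := by exact_mod_cast ha
  have hR0 : (0 : ℝ) < rho a := by linarith
  have hz : z = 0 := by
    have : |(z : ℝ)| * rho a ^ 2 < 1 * rho a ^ 2 := by
      have : (rho a + 2) * |φ₁ ha0 h (elt a x y z)| ≤ (rho a + 2) * 20 := by gcongr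
      have : (rho a + 1) * |φ₂ ha0 h (elt a x y z)| ≤ (rho a + 1) * 30 := by gcongr
      nlinarith
    have := lt_of_mul_lt_mul_right this (by positivity)
    rw [← Int.abs_lt_one_iff]
    exact_mod_cast this
  subst hz
  have hy : y = 0 := by
    rw [φ₀_elt] at h0
    rw [φ₁_elt] at h1
    have hd : |(y : ℝ) * (rho a - rho₁ a)| ≤ 20 + 20 := by
      have := abs_sub (x + y * rho a + (0 : ℤ) * rho a ^ 2 : ℝ)
        (x + y * rho₁ a + (0 : ℤ) * rho₁ a ^ 2)
      refine le_trans (le_of_eq ?_) (this.trans (add_le_add h0 h1))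
      congr 1
      push_cast
      ring
    have hr : rho a ≤ rho a - rho₁ a := by
      have : 0 ≤ 1 / (1 + rho a) := by positivity
      have e : rho₁ a = -(1 / (1 + rho a)) := by rw [rho₁]; ring
      linarith
    rw [abs_mul, abs_of_pos (hR0.trans_le hr)] at hd
    have : |(y : ℝ)| * rho a < 1 * rho a := by
      have : |(y : ℝ)| * rho a ≤ |(y : ℝ)| * (rho a - rho₁ a) := by gcongr
      linarith
    have := lt_of_mul_lt_mul_right this hR0.le
    rw [← Int.abs_lt_one_iff]
    exact_mod_cast this
  subst hy
  exact ⟨x, by simp [elt]⟩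

theorem span_injOn_balancedPairs (T : ℕ) :
    Set.InjOn (fun t : ℕ × ℕ => Ideal.span {elt a (-t.1) t.2 0}) (balancedPairs T : Set (ℕ × ℕ)) := by
  have ha0 : 0 ≤ a := by omega
  have hR := (rho_bounds ha0).1
  have haR : (100 : ℝ) ≤ a := by exact_mod_cast ha
  have hR0 : (0 : ℝ) < rho a := by linarith
  rintro ⟨m, n⟩ hmn ⟨m', n'⟩ hmn' heq
  obtain ⟨hm, hn, hc, hTm, hTn⟩ := mem_balancedPairs.1 hmn
  obtain ⟨hm', hn', hc', hTm', hTn'⟩ := mem_balancedPairs.1 hmn'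
  dsimp only at *
  have hT : (0 : ℝ) < T := by exact_mod_cast hm.1.trans_le hm.2
  obtain ⟨u, hu⟩ := Ideal.span_singleton_eq_span_singleton.1 heq
  obtain ⟨⟨a1, a2⟩, ⟨a3, a4⟩, a5, a6⟩ := embeddings_balanced ha h hm hn hTm hTn
  obtain ⟨⟨b1, b2⟩, ⟨b3, b4⟩, b5, b6⟩ := embeddings_balanced ha h hm' hn' hTm' hTn'
  have hratio : ∀ (φ : 𝓞 (CubicField a) →ₐ[ℤ] ℝ) (l B : ℝ), 0 < l →
      l ≤ |φ (elt a (-m) n 0)| → |φ (elt a (-m') n' 0)| ≤ B * l → |φ u| ≤ B := by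
    intro φ l B hl h1 h2
    rw [← hu, map_mul, abs_mul] at h2
    refine le_of_mul_le_mul_left ?_ hl
    calc l * |φ u| ≤ |φ (elt a (-m) n 0)| * |φ u| := by gcongr
      _ ≤ B * l := h2
      _ = l * B := mul_comm _ _
  obtain ⟨x, hx⟩ := eq_intCast_of_embeddings_le ha h
    (hratio _ (T * rho a / 20) 20 (by positivity) a1 (by linarith))
    (hratio _ (T / 10) 20 (by positivity) a3 (by linarith))
    (hratio _ (T / 10) 30 (by positivity) a5 (by linarith))
  have he : elt a (-m) n 0 * (x : 𝓞 (CubicField a)) = elt a (-m * x) (n * x) 0 := by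
    simp only [elt]; push_cast; ring
  rw [hx, he, elt_inj h] at hu
  -- Positivity of n and n' excludes the unit -1; coprimality of m' and n' then gives x = 1.
  have hx0 : 0 < x := by
    have : (0 : ℤ) < n * x := by rw [hu.2.1]; exact_mod_cast hn'.1
    exact (pos_iff_pos_of_mul_pos this).1 (by exact_mod_cast hn.1)
  lift x to ℕ using hx0.le
  have h1 : m * x = m' := by
    have := hu.1
    rw [neg_mul, neg_inj] at this
    exact_mod_cast this
  have h2 : n * x = n' := by exact_mod_cast hu.2.1
  have h3 : x = 1 := by
    have := Nat.dvd_gcd (Dvd.intro_left m h1) (Dvd.intro_left n h2)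
    rw [hc'] at this
    exact Nat.dvd_one.1 this
  subst h3
  rw [← h1, ← h2, mul_one, mul_one]

omit h in
theorem abs_norm_form_le {T m n : ℕ} (hm : m ≤ T) (hn : n ≤ T) :
    |a * (-m * n * (-m - n)) + ((-m) ^ 3 - 3 * -m * n ^ 2 + n ^ 3)| ≤ 3 * a * T ^ 3 := by
  have hm' : (m : ℤ) ≤ T := by exact_mod_cast hm
  have hn' : (n : ℤ) ≤ T := by exact_mod_cast hn
  have hm0 : (0 : ℤ) ≤ m := by positivity
  have hn0 : (0 : ℤ) ≤ n := by positivity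
  generalize (m : ℤ) = m at *
  generalize (n : ℤ) = n at *
  generalize (T : ℤ) = T at *
  have hT : 0 ≤ T := hm0.trans hm'
  have p1 : m * n * (m + n) ≤ T * T * (T + T) := by gcongr
  have p2 : m ^ 3 ≤ T ^ 3 := by gcongr
  have p3 : m * n ^ 2 ≤ T * T ^ 2 := by gcongr
  have p4 : n ^ 3 ≤ T ^ 3 := by gcongr
  have q1 : 0 ≤ m * n * (m + n) := by positivity
  have q2 : 0 ≤ m ^ 3 := by positivity
  have q3 : 0 ≤ m * n ^ 2 := by positivity
  have q4 : 0 ≤ n ^ 3 := by positivity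
  have r1 : a * (m * n * (m + n)) ≤ a * (T * T * (T + T)) := by gcongr
  have r2 : 0 ≤ a * (m * n * (m + n)) := mul_nonneg (by omega) q1
  have r3 : 100 * T ^ 3 ≤ a * T ^ 3 := by gcongr
  rw [abs_le]
  constructor <;> nlinarith

omit ha h in
theorem finite_countLT (X : ℝ) :
    {I ∈ primitivePrincipalIdeals a | (Ideal.absNorm I : ℝ) < X}.Finite := by
  refine (Ideal.finite_setOfPred_absNorm_le ⌈X⌉₊).subset ?_
  rintro I ⟨-, hI⟩
  exact_mod_cast hI.le.trans (Nat.le_ceil X)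

omit ha h in
-- The unit ideal is primitive and principal.
theorem one_le_countLT {X : ℝ} (hX : 1 < X) : 1 ≤ countLT a X := by
  rw [countLT, Nat.one_le_iff_ne_zero, Ne, Set.ncard_eq_zero (finite_countLT X)]
  refine Set.Nonempty.ne_empty ⟨⊤, ⟨?_, ?_⟩, ?_⟩
  · rw [← Ideal.span_singleton_one, isPrimitive_span_iff]
    intro n hn hdvd
    have hu : IsUnit (n : 𝓞 (CubicField a)) := isUnit_of_dvd_one hdvd
    have h1 := Ideal.span_singleton_eq_top.2 hu
    have h2 := Ideal.absNorm_span_natCast (S := 𝓞 (CubicField a)) n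
    rw [h1, Ideal.absNorm_top] at h2
    have h3 : Module.finrank ℤ (𝓞 (CubicField a)) ≠ 0 :=
      Module.finrank_pos.ne'
    have := Nat.one_lt_pow h3 hn
    omega
  · exact ⟨1, by simp⟩
  · simpa using hX

theorem card_balancedPairs_le_countLT {X : ℝ} {T : ℕ} (hT : 3 * (a : ℝ) * T ^ 3 < X) :
    (balancedPairs T).card ≤ countLT a X := by
  classical
  rw [← Finset.card_image_of_injOn (span_injOn_balancedPairs ha h T), ← Set.ncard_coe_finset]
  refine Set.ncard_le_ncard ?_ (finite_countLT X)
  intro I hI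
  obtain ⟨⟨m, n⟩, ht, rfl⟩ := Finset.mem_image.1 (Finset.mem_coe.1 hI)
  obtain ⟨hm, hn, hc, -, -⟩ := mem_balancedPairs.1 ht
  refine ⟨⟨(isPrimitive_span_iff _).2 (not_dvd_elt_of_coprime h hc), ⟨_, rfl⟩⟩, ?_⟩
  rw [Ideal.absNorm_span_singleton, Nat.cast_natAbs, norm_elt h]
  refine lt_of_le_of_lt ?_ hT
  exact_mod_cast abs_norm_form_le ha hm.2 hn.2

/-- Lower bound for the number of primitive principal ideals of norm less than `X`. -/
theorem le_countLT {X : ℝ} (hX : a ≤ X) :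
    1 / 100 * (X / a) ^ (2 / 3 : ℝ) ≤ countLT a X := by
  have haR : (100 : ℝ) ≤ a := by exact_mod_cast ha
  have ha' : (0 : ℝ) < a := by linarith
  have hX0 : 0 < X := ha'.trans_le hX
  obtain ⟨s, hs⟩ : ∃ s : ℝ, s = (X / a) ^ (1 / 3 : ℝ) := ⟨_, rfl⟩
  have hXa : 1 ≤ X / a := by rwa [one_le_div ha']
  have hs1 : 1 ≤ s := by rw [hs]; exact Real.one_le_rpow hXa (by norm_num)
  have hs3 : s ^ 3 = X / a := by
    rw [hs, ← Real.rpow_natCast, ← Real.rpow_mul (by positivity)]; norm_num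
  have hs2 : s ^ 2 = (X / a) ^ (2 / 3 : ℝ) := by
    rw [hs, ← Real.rpow_natCast, ← Real.rpow_mul (by positivity)]; norm_num
  rw [← hs2]
  -- For s < 2 the unit ideal suffices. Otherwise T = ⌊s/2⌋ is at least s/4, and 3aT³ ≤ 3X/8 keeps
  -- the norm strictly below X.
  rcases lt_or_ge s 2 with h2 | h2
  · have : (1 : ℝ) ≤ countLT a X := by exact_mod_cast one_le_countLT (by linarith)
    nlinarith
  · have hfl : (⌊s / 2⌋₊ : ℝ) ≤ s / 2 := Nat.floor_le (by linarith)
    have hfl' : s / 4 ≤ (⌊s / 2⌋₊ : ℝ) := by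
      have h1 := Nat.lt_floor_add_one (s / 2)
      have h2 : (1 : ℝ) ≤ (⌊s / 2⌋₊ : ℝ) := by
        exact_mod_cast Nat.one_le_floor_iff _ |>.2 (by linarith)
      linarith
    have hT : 3 * (a : ℝ) * (⌊s / 2⌋₊ : ℝ) ^ 3 < X := by
      have h1 : (⌊s / 2⌋₊ : ℝ) ^ 3 ≤ (s / 2) ^ 3 := by gcongr
      have h2 : a * s ^ 3 = X := by rw [hs3]; field_simp
      have h3 : 3 * (a : ℝ) * (⌊s / 2⌋₊ : ℝ) ^ 3 ≤ 3 * a * (s / 2) ^ 3 := by gcongr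
      have h4 : 3 * a * (s / 2) ^ 3 = 3 / 8 * (a * s ^ 3) := by ring
      linarith
    have h1 : ((balancedPairs ⌊s / 2⌋₊).card : ℝ) ≤ countLT a X := by
      exact_mod_cast card_balancedPairs_le_countLT ha h hT
    have h2 : 3 * (⌊s / 2⌋₊ : ℝ) ^ 2 ≤ 10 * ((balancedPairs ⌊s / 2⌋₊).card : ℝ) := by
      exact_mod_cast three_mul_sq_le_card_balancedPairs ⌊s / 2⌋₊
    have h3 : (s / 4) ^ 2 ≤ (⌊s / 2⌋₊ : ℝ) ^ 2 := by gcongr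
    nlinarith

end LowerBound

/-! ### Specialising X and absorbing small a. -/

theorem count_mono (a : ℤ) {X Y : ℝ} (hXY : X ≤ Y) : count a X ≤ count a Y := by
  refine Set.ncard_le_ncard (fun I hI => ⟨hI.1, hI.2.trans hXY⟩)
    ((finite_countLT (a := a) (Y + 1)).subset fun I hI => ⟨hI.1, ?_⟩)
  have := hI.2
  linarith

theorem countLT_le_count (a : ℤ) (X : ℝ) : countLT a X ≤ count a X := by
  refine Set.ncard_le_ncard (fun I hI => ⟨hI.1, hI.2.le⟩)
    ((finite_countLT (a := a) (X + 1)).subset fun I hI => ⟨hI.1, ?_⟩)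
  have := hI.2
  linarith

theorem one_le_count {a : ℤ} {X : ℝ} (hX : 1 ≤ X) : 1 ≤ count a X := by
  refine le_trans ?_ (count_mono a hX)
  refine (one_le_countLT (a := a) one_lt_two).trans
    (Set.ncard_le_ncard (fun I hI => ⟨hI.1, ?_⟩) ((finite_countLT (a := a) 2).subset
      fun I hI => ⟨hI.1, hI.2.trans_lt one_lt_two⟩))
  have h2 : (Ideal.absNorm I : ℝ) < 2 := hI.2
  have h3 : Ideal.absNorm I < 2 := by exact_mod_cast h2
  exact_mod_cast Nat.lt_succ_iff.1 h3

theorem discr_rpow_half {a : ℤ} (ha : -1 ≤ a) (h : IsMonogenic a) :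
    (NumberField.discr (CubicField a) : ℝ) ^ (1 / 2 : ℝ) = (a : ℝ) ^ 2 + 3 * a + 9 := by
  have ha' : (-1 : ℝ) ≤ a := by exact_mod_cast ha
  rw [discr_eq h]
  push_cast
  rw [← Real.sqrt_eq_rpow, Real.sqrt_sq (by nlinarith)]

theorem discr_rpow_sixth {a : ℤ} (ha : -1 ≤ a) (h : IsMonogenic a) :
    (NumberField.discr (CubicField a) : ℝ) ^ (1 / 6 : ℝ) =
      ((a : ℝ) ^ 2 + 3 * a + 9) ^ (1 / 3 : ℝ) := by
  have ha' : (-1 : ℝ) ≤ a := by exact_mod_cast ha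
  rw [discr_eq h]
  push_cast
  rw [← Real.rpow_natCast, ← Real.rpow_mul (by nlinarith)]
  norm_num

theorem exists_forall_le (f : ℤ → ℕ) (s : Finset ℤ) : ∃ B : ℕ, ∀ a ∈ s, f a ≤ B :=
  ⟨s.sup f, fun _ ha => Finset.le_sup ha⟩

theorem exists_count_bounds : ∃ c C : ℝ, 0 < c ∧ 0 < C ∧
    ∀ a : ℤ, 1 ≤ a → IsMonogenic a → ∀ δ : ℝ, 0 ≤ δ → δ ≤ 1 →
      c * (a : ℝ) ^ (2 * δ / 3) ≤ (count a ((a : ℝ) ^ (1 + δ)) : ℝ) ∧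
      (count a ((a : ℝ) ^ (1 + δ)) : ℝ) ≤ C * (a : ℝ) ^ (2 * δ / 3) := by
  obtain ⟨K, hK, hcount⟩ := exists_count_le
  obtain ⟨B, hB⟩ := exists_forall_le (fun a : ℤ => count a ((a : ℝ) ^ 2)) (Finset.Icc 1 100)
  refine ⟨1 / 100, K + B, by norm_num, by positivity, ?_⟩
  intro a ha h δ hδ0 hδ1
  have haR : (1 : ℝ) ≤ a := by exact_mod_cast ha
  have ha0 : (0 : ℝ) < a := by linarith
  have hpow2 : (a : ℝ) ^ (1 + δ) ≤ (a : ℝ) ^ 2 := by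
    rw [← Real.rpow_natCast]
    exact Real.rpow_le_rpow_of_exponent_le haR (by push_cast; linarith)
  have hpow1 : (a : ℝ) ≤ (a : ℝ) ^ (1 + δ) := by
    conv_lhs => rw [← Real.rpow_one (a : ℝ)]
    exact Real.rpow_le_rpow_of_exponent_le haR (by linarith)
  have hone : 1 ≤ (a : ℝ) ^ (2 * δ / 3) := Real.one_le_rpow haR (by positivity)
  rcases le_or_gt 100 a with hbig | hsmall
  · have hXa : ((a : ℝ) ^ (1 + δ) / a) ^ (2 / 3 : ℝ) = (a : ℝ) ^ (2 * δ / 3) := by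
      rw [Real.rpow_add ha0, Real.rpow_one, mul_div_cancel_left₀ _ ha0.ne',
        ← Real.rpow_mul ha0.le]
      congr 1
      ring
    rw [← hXa] at hone ⊢
    constructor
    · refine (le_countLT hbig h hpow1).trans ?_
      exact_mod_cast countLT_le_count a _
    · refine (hcount a (by omega) h _ hpow1 (by linarith [sq_nonneg (a : ℝ)])).trans ?_
      gcongr
      linarith [Nat.cast_nonneg (α := ℝ) B]
  · constructor
    · have h1 : (1 : ℝ) ≤ count a ((a : ℝ) ^ (1 + δ)) := by
        exact_mod_cast one_le_count (haR.trans hpow1)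
      have h2 : (a : ℝ) ^ (2 * δ / 3) ≤ 100 := by
        calc (a : ℝ) ^ (2 * δ / 3) ≤ (a : ℝ) ^ (1 : ℝ) :=
              Real.rpow_le_rpow_of_exponent_le haR (by linarith)
          _ = a := Real.rpow_one _
          _ ≤ 100 := by exact_mod_cast hsmall.le
      linarith
    · have h1 : count a ((a : ℝ) ^ (1 + δ)) ≤ B := (count_mono a hpow2).trans
        (hB a (Finset.mem_Icc.2 ⟨ha, hsmall.le⟩))
      have h2 : (count a ((a : ℝ) ^ (1 + δ)) : ℝ) ≤ B := by exact_mod_cast h1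
      nlinarith

/-- With D = a² + 3a + 9 and a ≥ 100, D ≤ (D/a)² ≤ 8D, so (D/a)^(2/3) is D^(1/3) up to a factor 2.
Since D exceeds a², the upper bound is needed up to 2a². -/
theorem exists_countLT_bounds : ∃ c C : ℝ, 0 < c ∧ 0 < C ∧
    ∀ a : ℤ, -1 ≤ a → IsMonogenic a →
      c * (NumberField.discr (CubicField a) : ℝ) ^ (1 / 6 : ℝ) ≤
        (countLT a ((NumberField.discr (CubicField a) : ℝ) ^ (1 / 2 : ℝ)) : ℝ) ∧
      (countLT a ((NumberField.discr (CubicField a) : ℝ) ^ (1 / 2 : ℝ)) : ℝ) ≤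
        C * (NumberField.discr (CubicField a) : ℝ) ^ (1 / 6 : ℝ) := by
  obtain ⟨K, hK, hcount⟩ := exists_count_le
  obtain ⟨B, hB⟩ := exists_forall_le (fun a : ℤ => countLT a ((a : ℝ) ^ 2 + 3 * a + 9))
    (Finset.Icc (-1) 100)
  refine ⟨1 / 100000, K * 2 + B, by norm_num, by positivity, ?_⟩
  intro a ha h
  rw [discr_rpow_half ha h, discr_rpow_sixth ha h]
  have haR : (-1 : ℝ) ≤ a := by exact_mod_cast ha
  obtain ⟨D, hD⟩ : ∃ D : ℝ, D = (a : ℝ) ^ 2 + 3 * a + 9 := ⟨_, rfl⟩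
  rw [← hD]
  have hD1 : 1 < D := by nlinarith
  have hone : 1 ≤ D ^ (1 / 3 : ℝ) := Real.one_le_rpow hD1.le (by norm_num)
  rcases le_or_gt 100 a with hbig | hsmall
  · have haR : (100 : ℝ) ≤ a := by exact_mod_cast hbig
    have ha0 : (0 : ℝ) < a := by linarith
    have e : (D / a) ^ (2 / 3 : ℝ) = ((D / a) ^ 2) ^ (1 / 3 : ℝ) := by
      rw [← Real.rpow_natCast, ← Real.rpow_mul (by positivity)]
      norm_num
    have hlow : D ≤ (D / a) ^ 2 := by
      rw [div_pow, le_div_iff₀ (by positivity), sq D]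
      gcongr
      linarith
    have hup : (D / a) ^ 2 ≤ 8 * D := by
      have h1 : D ≤ 8 * a ^ 2 := by nlinarith
      rw [div_pow, div_le_iff₀ (by positivity), sq D]
      calc D * D ≤ D * (8 * a ^ 2) := by gcongr
        _ = _ := by ring
    have hlow' : D ^ (1 / 3 : ℝ) ≤ (D / a) ^ (2 / 3 : ℝ) := by
      rw [e]
      exact Real.rpow_le_rpow (by linarith) hlow (by norm_num)
    have hup' : (D / a) ^ (2 / 3 : ℝ) ≤ 2 * D ^ (1 / 3 : ℝ) := by
      rw [e]
      refine (Real.rpow_le_rpow (by positivity) hup (by norm_num)).trans (le_of_eq ?_)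
      rw [Real.mul_rpow (by norm_num) (by linarith), show (8 : ℝ) = 2 ^ (3 : ℝ) by norm_num,
        ← Real.rpow_mul (by norm_num)]
      norm_num
    have haD : (a : ℝ) ≤ D := by nlinarith
    constructor
    · have := le_countLT hbig h haD
      linarith
    · have h1 : (countLT a D : ℝ) ≤ count a D := by exact_mod_cast countLT_le_count a D
      have h2 := hcount a (by omega) h D haD (by nlinarith)
      have h3 : K * (D / a) ^ (2 / 3 : ℝ) ≤
          K * (2 * D ^ (1 / 3 : ℝ)) := by gcongr
      have h4 : (0 : ℝ) ≤ B * D ^ (1 / 3 : ℝ) := by positivity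
      linarith
  · have haR' : (a : ℝ) ≤ 100 := by exact_mod_cast hsmall.le
    constructor
    · have h1 : (1 : ℝ) ≤ countLT a D := by exact_mod_cast one_le_countLT hD1
      have h2 : D ^ (1 / 3 : ℝ) ≤ D ^ (1 : ℝ) :=
        Real.rpow_le_rpow_of_exponent_le hD1.le (by norm_num)
      rw [Real.rpow_one] at h2
      have h3 : D ≤ 100000 := by nlinarith
      linarith
    · have h1 : countLT a D ≤ B := by
        rw [hD]
        exact hB a (Finset.mem_Icc.2 ⟨ha, hsmall.le⟩)
      have h2 : (countLT a D : ℝ) ≤ B := by exact_mod_cast h1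
      have h3 : (0 : ℝ) ≤ K * 2 * D ^ (1 / 3 : ℝ) := by positivity
      have h4 : (B : ℝ) ≤ B * D ^ (1 / 3 : ℝ) :=
        le_mul_of_one_le_right (Nat.cast_nonneg _) hone
      linarith

end SimplestCubic

theorem theorem1p3 :
    (∃ c C : ℝ, 0 < c ∧ 0 < C ∧
      ∀ a : ℤ, 1 ≤ a → SimplestCubic.IsMonogenic a →
        ∀ δ : ℝ, 0 ≤ δ → δ ≤ 1 →
          c * (a : ℝ) ^ (2 * δ / 3) ≤ (SimplestCubic.count a ((a : ℝ) ^ (1 + δ)) : ℝ) ∧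
          (SimplestCubic.count a ((a : ℝ) ^ (1 + δ)) : ℝ) ≤ C * (a : ℝ) ^ (2 * δ / 3)) ∧
    (∃ c C : ℝ, 0 < c ∧ 0 < C ∧
      ∀ a : ℤ, -1 ≤ a → SimplestCubic.IsMonogenic a →
        c * (NumberField.discr (SimplestCubic.CubicField a) : ℝ) ^ (1 / 6 : ℝ) ≤
          (SimplestCubic.countLT a
            ((NumberField.discr (SimplestCubic.CubicField a) : ℝ) ^ (1 / 2 : ℝ)) : ℝ) ∧
        (SimplestCubic.countLT a
            ((NumberField.discr (SimplestCubic.CubicField a) : ℝ) ^ (1 / 2 : ℝ)) : ℝ) ≤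
          C * (NumberField.discr (SimplestCubic.CubicField a) : ℝ) ^ (1 / 6 : ℝ)) := by
  exact ⟨SimplestCubic.exists_count_bounds, SimplestCubic.exists_countLT_bounds⟩
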